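/- **Corollary ($L^p$-uncertainty type inequality).** Let $M$ be a complete noncompact smooth Riemannian manifold (without boundary, second countable) of dimension $n>1$, with Riemannian volume measure $dx$. Let $C>0$, and let $\rho:M\to[0,\infty)$ be a locally Lipschitz function such that $|\nabla\rho|=1$ almost everywhere on $M\setminus\rho^{-1}\{0\}$ and $\Delta\rho\ge \frac{C}{\rho}$ on $M\setminus\rho^{-1}\{0\}$ in the sense of distributions, that is, $$-\int_M\langle\nabla\rho,\nabla\psi\rangle\,dx\;\ge\;\int_M\frac{C}{\rho}\,\psi\,dx\qquad\text{for all } 0\le\psi\in C_c^\infty(M\setminus\rho^{-1}\{0\}).$$ Let $p,q$ be real numbers with $1<p<\infty$, $\frac1p+\frac1q=1$ and $C+1-p>0$. Then for every real-valued $\phi\in C_c^\infty(M\setminus\rho^{-1}\{0\})$ the functions $\rho^q|\phi|^q$, $|\nabla\phi|^p$ and $\phi^2$ are integrable on $M$, and $$\Big(\int_M\rho^q|\phi|^q\,dx\Big)^{1/q}\Big(\int_M|\nabla\phi|^p\,dx\Big)^{1/p}\;\ge\;\frac{C+1-p}{p}\int_M\phi^2\,dx .$$ -/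

import Mathlib

open MeasureTheory Manifold Bundle
open scoped ContDiff ENNReal

noncomputable section

namespace RiemannianHardy

variable {n : ℕ} {M : Type*} [TopologicalSpace M]
  [ChartedSpace (EuclideanSpace ℝ (Fin n)) M] [IsManifold (𝓡 n) ∞ M]
  [RiemannianBundle (fun x : M ↦ TangentSpace (𝓡 n) x)]

instance (x : M) : FiniteDimensional ℝ (TangentSpace (𝓡 n) x) :=
  inferInstanceAs (FiniteDimensional ℝ (EuclideanSpace ℝ (Fin n)))

instance (x : M) : CompleteSpace (TangentSpace (𝓡 n) x) :=
  FiniteDimensional.complete ℝ _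

/-- The Riemannian gradient of `f` at `x`: the tangent vector which represents the differential
of `f` at `x` through the Riemannian inner product. It is `0` if `f` is not differentiable
at `x`. -/
def grad (n : ℕ) {M : Type*} [TopologicalSpace M]
    [ChartedSpace (EuclideanSpace ℝ (Fin n)) M] [IsManifold (𝓡 n) ∞ M]
    [RiemannianBundle (fun x : M ↦ TangentSpace (𝓡 n) x)]
    (f : M → ℝ) (x : M) : TangentSpace (𝓡 n) x :=
  (InnerProductSpace.toDual ℝ (TangentSpace (𝓡 n) x)).symm (mfderiv (𝓡 n) 𝓘(ℝ, ℝ) f x)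

/-- The coordinate vector field `∂ᵢ` of the chart at `x`, at the point with coordinates `y`. -/
def coordVector (x : M) (y : EuclideanSpace ℝ (Fin n)) (i : Fin n) :
    TangentSpace (𝓡 n) ((extChartAt (𝓡 n) x).symm y) :=
  mfderiv 𝓘(ℝ, EuclideanSpace ℝ (Fin n)) (𝓡 n) (extChartAt (𝓡 n) x).symm y
    (EuclideanSpace.single i (1 : ℝ))

/-- The volume density `√(det (gᵢⱼ))` in the chart at `x`, where `gᵢⱼ = ⟨∂ᵢ, ∂ⱼ⟩`. -/
def volumeDensity (x : M) (y : EuclideanSpace ℝ (Fin n)) : ℝ :=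
  √(Matrix.gram ℝ (coordVector x y)).det

/-- The Riemannian volume of the domain of the chart at `x`: the measure `√(det g) dy` on the
image of the chart, transported to `M`. -/
def chartVolume [MeasurableSpace M] (x : M) : Measure M :=
  (((volume : Measure (EuclideanSpace ℝ (Fin n))).restrict
      (extChartAt (𝓡 n) x).target).withDensity
    (fun y ↦ ENNReal.ofReal (volumeDensity x y))).map (extChartAt (𝓡 n) x).symm

/-- The Riemannian volume measure. The measures `chartVolume x` agree on the overlaps of the
charts, and their supremum (in the complete lattice of measures) is the measure on `M` which
restricts to `chartVolume x` on the domain of the chart at `x`, for every `x`. -/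
def riemannianVolume (n : ℕ) (M : Type*) [TopologicalSpace M]
    [ChartedSpace (EuclideanSpace ℝ (Fin n)) M] [IsManifold (𝓡 n) ∞ M]
    [RiemannianBundle (fun x : M ↦ TangentSpace (𝓡 n) x)] [MeasurableSpace M] : Measure M :=
  ⨆ x : M, chartVolume (n := n) x

/-- `φ ∈ C_c^∞(M ∖ Z)`, extended by zero to `M`. -/
structure IsTestFunctionOff (n : ℕ) {M : Type*} [TopologicalSpace M]
    [ChartedSpace (EuclideanSpace ℝ (Fin n)) M] (Z : Set M) (φ : M → ℝ) : Prop where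
  smooth : ContMDiff (𝓡 n) 𝓘(ℝ, ℝ) ∞ φ
  hasCompactSupport : HasCompactSupport φ
  disjoint : Disjoint (tsupport φ) Z

/-- `Δρ ≥ C / ρ` in the sense of distributions on `M ∖ ρ⁻¹(0)`, for a locally Lipschitz `ρ`.
Here `Δρ` is the distributional divergence of the locally bounded vector field `∇ρ`, that is
`⟨Δρ, ψ⟩ = -∫ ⟨∇ρ, ∇ψ⟩`. -/
def LaplacianGEDiv (n : ℕ) {M : Type*} [TopologicalSpace M]
    [ChartedSpace (EuclideanSpace ℝ (Fin n)) M] [IsManifold (𝓡 n) ∞ M]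
    [RiemannianBundle (fun x : M ↦ TangentSpace (𝓡 n) x)] [MeasurableSpace M]
    (ρ : M → ℝ) (C : ℝ) : Prop :=
  ∀ ψ : M → ℝ, IsTestFunctionOff n (ρ ⁻¹' {0}) ψ → (∀ x, 0 ≤ ψ x) →
    ∫ x, C / ρ x * ψ x ∂(riemannianVolume n M) ≤
      -∫ x, inner ℝ (grad n ρ x) (grad n ψ x) ∂(riemannianVolume n M)

end RiemannianHardy

end

/-! The inequality is a Hardy inequality combined with Hölder. Since φ vanishes where ρ does, φ² =
(|φ|/ρ)·(ρ|φ|), so ∫φ² ≤ (∫(|φ|/ρ)^p)^(1/p) (∫ρ^q|φ|^q)^(1/q), and it remains to see that (C+1-p)/p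
· (∫(|φ|/ρ)^p)^(1/p) ≤ (∫|∇φ|^p)^(1/p).

For this Hardy inequality (`hardy_aux`), the condition Δρ ≥ C/ρ is tested against ψ = ρ^(1-p)|φ|^p.
The left side is C∫(|φ|/ρ)^p. As |∇ρ| = 1, the right side is at most (p-1)∫(|φ|/ρ)^p +
p∫|∇φ|(|φ|/ρ)^(p-1). Hölder bounds the last integral, because (p-1)q = p; dividing by
(∫(|φ|/ρ)^p)^(1/q) gives the claim (`uncertainty_of_hardy_holder`).

The difficulty is that ψ is only Lipschitz, as ρ is, whereas the hypothesis concerns smooth test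
functions. `LaplacianGEDiv.of_chartLipschitz` closes this gap: a partition of unity localizes ψ to
charts, where it is mollified (`exists_smooth_approx_of_lipschitz`). The derivatives converge almost
everywhere and stay bounded, so dominated convergence applies.

To work in charts, the volume, defined as a supremum of chart measures, must be shown to agree with
each of them on its chart domain (`riemannianVolume_apply_of_subset`), and Lipschitz continuity for
the Riemannian distance must imply Lipschitz continuity in coordinates. -/

set_option linter.unusedSectionVars false

noncomputable section

namespace RiemannianHardy

open Filter Set Topology
open scoped NNReal

/-! ### Differentials, gradients and the metric tensor in a chart -/

variable {n : ℕ} {M : Type*} [TopologicalSpace M]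
  [ChartedSpace (EuclideanSpace ℝ (Fin n)) M] [IsManifold (𝓡 n) ∞ M]
  [RiemannianBundle (fun x : M ↦ TangentSpace (𝓡 n) x)]

/-- The differential at `x` of the chart at `x₀`. -/
def chartDeriv (x₀ x : M) : TangentSpace (𝓡 n) x →L[ℝ] EuclideanSpace ℝ (Fin n) :=
  (trivializationAt (EuclideanSpace ℝ (Fin n)) (TangentSpace (𝓡 n)) x₀).continuousLinearMapAt ℝ x

/-- The inverse of the differential at `x` of the chart at `x₀`. -/
def chartFrame (x₀ x : M) : EuclideanSpace ℝ (Fin n) →L[ℝ] TangentSpace (𝓡 n) x :=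
  (trivializationAt (EuclideanSpace ℝ (Fin n)) (TangentSpace (𝓡 n)) x₀).symmL ℝ x

lemma chartDeriv_chartFrame {x₀ x : M} (hx : x ∈ (extChartAt (𝓡 n) x₀).source)
    (v : EuclideanSpace ℝ (Fin n)) : chartDeriv x₀ x (chartFrame x₀ x v) = v :=
  Trivialization.continuousLinearMapAt_symmL _ (by simpa using hx) v

lemma chartFrame_chartDeriv {x₀ x : M} (hx : x ∈ (extChartAt (𝓡 n) x₀).source)
    (v : TangentSpace (𝓡 n) x) : chartFrame x₀ x (chartDeriv x₀ x v) = v :=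
  Trivialization.symmL_continuousLinearMapAt _ (by simpa using hx) v

lemma chartDeriv_eq {x₀ x : M} (hx : x ∈ (extChartAt (𝓡 n) x₀).source) :
    chartDeriv x₀ x = mfderiv (𝓡 n) 𝓘(ℝ, EuclideanSpace ℝ (Fin n)) (extChartAt (𝓡 n) x₀) x :=
  TangentBundle.continuousLinearMapAt_trivializationAt (by simpa using hx)

lemma chartFrame_eq {x₀ x : M} (hx : x ∈ (extChartAt (𝓡 n) x₀).source) :
    chartFrame x₀ x = mfderiv 𝓘(ℝ, EuclideanSpace ℝ (Fin n)) (𝓡 n) (extChartAt (𝓡 n) x₀).symm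
      (extChartAt (𝓡 n) x₀ x) := by
  rw [← mfderivWithin_univ]
  have := TangentBundle.symmL_trivializationAt (I := 𝓡 n) (𝕜 := ℝ) (x₀ := x₀) (x := x)
    (by simpa using hx)
  rw [chartFrame, this, modelWithCornersSelf_coe, range_id]

lemma hasMFDerivAt_extChartAt {x₀ x : M} (hx : x ∈ (extChartAt (𝓡 n) x₀).source) :
    HasMFDerivAt (𝓡 n) 𝓘(ℝ, EuclideanSpace ℝ (Fin n)) (extChartAt (𝓡 n) x₀) x
      (chartDeriv x₀ x) := by
  rw [chartDeriv_eq hx]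
  exact (mdifferentiableAt_extChartAt (by simpa using hx)).hasMFDerivAt

lemma mdifferentiableAt_iff_chart {x₀ x : M} (hx : x ∈ (extChartAt (𝓡 n) x₀).source) (f : M → ℝ) :
    MDifferentiableAt (𝓡 n) 𝓘(ℝ, ℝ) f x ↔
      DifferentiableAt ℝ (f ∘ (extChartAt (𝓡 n) x₀).symm) (extChartAt (𝓡 n) x₀ x) := by
  have hf : f =ᶠ[𝓝 x] (f ∘ (extChartAt (𝓡 n) x₀).symm) ∘ extChartAt (𝓡 n) x₀ := by
    filter_upwards [(isOpen_extChartAt_source (I := 𝓡 n) x₀).mem_nhds hx] with y hy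
    simp only [Function.comp_apply, (extChartAt (𝓡 n) x₀).left_inv hy]
  constructor
  · intro hm
    rw [← mdifferentiableAt_iff_differentiableAt]
    have hs : MDifferentiableAt 𝓘(ℝ, EuclideanSpace ℝ (Fin n)) (𝓡 n) (extChartAt (𝓡 n) x₀).symm
        (extChartAt (𝓡 n) x₀ x) :=
      (contMDiffOn_extChartAt_symm (n := ∞) x₀).contMDiffAt
        ((isOpen_extChartAt_target (I := 𝓡 n) x₀).mem_nhds
          ((extChartAt (𝓡 n) x₀).map_source hx)) |>.mdifferentiableAt (by simp)
    refine MDifferentiableAt.comp _ ?_ hs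
    rwa [(extChartAt (𝓡 n) x₀).left_inv hx]
  · intro hd
    exact (HasMFDerivAt.comp x hd.hasFDerivAt.hasMFDerivAt
      (hasMFDerivAt_extChartAt hx)).congr_of_eventuallyEq hf |>.mdifferentiableAt

/-- The differential of a real function, as a linear form on the tangent space. -/
def differential (n : ℕ) {M : Type*} [TopologicalSpace M]
    [ChartedSpace (EuclideanSpace ℝ (Fin n)) M] (f : M → ℝ) (x : M) :
    TangentSpace (𝓡 n) x →L[ℝ] ℝ :=
  mfderiv (𝓡 n) 𝓘(ℝ, ℝ) f x

/-- The differential of a function in terms of its expression in a chart. -/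
lemma differential_eq_fderiv_comp {x₀ x : M} (hx : x ∈ (extChartAt (𝓡 n) x₀).source)
    (f : M → ℝ) :
    differential n f x =
      (fderiv ℝ (f ∘ (extChartAt (𝓡 n) x₀).symm) (extChartAt (𝓡 n) x₀ x)).comp
        (chartDeriv x₀ x) := by
  have hf : f =ᶠ[𝓝 x] (f ∘ (extChartAt (𝓡 n) x₀).symm) ∘ extChartAt (𝓡 n) x₀ := by
    filter_upwards [(isOpen_extChartAt_source (I := 𝓡 n) x₀).mem_nhds hx] with y hy
    simp only [Function.comp_apply, (extChartAt (𝓡 n) x₀).left_inv hy]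
  by_cases hd : DifferentiableAt ℝ (f ∘ (extChartAt (𝓡 n) x₀).symm) (extChartAt (𝓡 n) x₀ x)
  · have h1 := HasMFDerivAt.comp x hd.hasFDerivAt.hasMFDerivAt (hasMFDerivAt_extChartAt hx)
    exact (h1.congr_of_eventuallyEq hf).mfderiv
  · rw [fderiv_zero_of_not_differentiableAt hd, ContinuousLinearMap.zero_comp]
    exact mfderiv_zero_of_not_mdifferentiableAt
      (fun hm ↦ hd ((mdifferentiableAt_iff_chart hx f).1 hm))

lemma inner_grad_right (f : M → ℝ) (x : M) (v : TangentSpace (𝓡 n) x) :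
    inner ℝ v (grad n f x) = differential n f x v := by
  rw [real_inner_comm]
  exact InnerProductSpace.toDual_symm_apply

lemma norm_grad (f : M → ℝ) (x : M) : ‖grad n f x‖ = ‖differential n f x‖ :=
  (InnerProductSpace.toDual ℝ (TangentSpace (𝓡 n) x)).symm.norm_map (differential n f x)

/-- The metric tensor in the chart at `x₀`. -/
def chartMetric (x₀ x : M) :
    EuclideanSpace ℝ (Fin n) →L[ℝ] EuclideanSpace ℝ (Fin n) →L[ℝ] ℝ :=
  (innerSL ℝ (E := TangentSpace (𝓡 n) x)).bilinearComp (chartFrame x₀ x) (chartFrame x₀ x)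

lemma chartMetric_apply (x₀ x : M) (v w : EuclideanSpace ℝ (Fin n)) :
    chartMetric x₀ x v w = inner ℝ (chartFrame x₀ x v) (chartFrame x₀ x w) := rfl

lemma continuousOn_chartMetric
    [IsContinuousRiemannianBundle (EuclideanSpace ℝ (Fin n))
      (fun x : M ↦ TangentSpace (𝓡 n) x)] (x₀ : M) :
    ContinuousOn (chartMetric (n := n) x₀) (extChartAt (𝓡 n) x₀).source := by
  have key : ∀ v : EuclideanSpace ℝ (Fin n), ContinuousOn
      (fun x : M ↦ (⟨x, chartFrame x₀ x v⟩ : TangentBundle (𝓡 n) M))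
      (extChartAt (𝓡 n) x₀).source := by
    intro v
    have := (trivializationAt (EuclideanSpace ℝ (Fin n)) (TangentSpace (𝓡 n)) x₀).continuousOn_symm
    have h2 := this.comp (f := fun x : M ↦ (x, v)) (by fun_prop)
      (s := (extChartAt (𝓡 n) x₀).source) (fun x hx ↦ by simpa using hx)
    refine h2.congr fun x hx ↦ congrArg (TotalSpace.mk x) ?_
    exact Trivialization.symmL_apply _ (by simpa using hx) v
  refine continuousOn_clm_apply.2 fun v ↦ continuousOn_clm_apply.2 fun w ↦ ?_
  exact ContinuousOn.inner_bundle (key v) (key w)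

/-- Positive definiteness makes the map from vectors to covectors injective, and the two spaces have
the same finite dimension. -/
lemma isInvertible_chartMetric {x₀ x : M} (hx : x ∈ (extChartAt (𝓡 n) x₀).source) :
    (chartMetric (n := n) x₀ x).IsInvertible := by
  have hinj : Function.Injective (chartMetric (n := n) x₀ x).toLinearMap := by
    rw [← LinearMap.ker_eq_bot, LinearMap.ker_eq_bot']
    intro v hv
    have h0 : chartMetric x₀ x v v = 0 := by
      have : chartMetric x₀ x v = 0 := hv
      simp [this]
    rw [chartMetric_apply, inner_self_eq_zero] at h0
    rw [← chartDeriv_chartFrame hx v, h0, map_zero]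
  have hfr : Module.finrank ℝ (EuclideanSpace ℝ (Fin n)) =
      Module.finrank ℝ (EuclideanSpace ℝ (Fin n) →L[ℝ] ℝ) := by
    exact (InnerProductSpace.toDual ℝ (EuclideanSpace ℝ (Fin n))).toLinearEquiv.finrank_eq
  exact ⟨(LinearEquiv.ofInjectiveOfFinrankEq _ hinj hfr).toContinuousLinearEquiv, by ext; rfl⟩

/-- This is g^{ij} ∂ᵢf ∂ⱼh: in coordinates the gradient of f is the vector whose metric dual is df.
The right side is visibly a measurable function of the point. -/
lemma inner_grad_grad_eq {x₀ x : M} (hx : x ∈ (extChartAt (𝓡 n) x₀).source) (f h : M → ℝ) :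
    inner ℝ (grad n f x) (grad n h x) =
      fderiv ℝ (h ∘ (extChartAt (𝓡 n) x₀).symm) (extChartAt (𝓡 n) x₀ x)
        ((chartMetric x₀ x).inverse
          (fderiv ℝ (f ∘ (extChartAt (𝓡 n) x₀).symm) (extChartAt (𝓡 n) x₀ x))) := by
  rw [inner_grad_right, differential_eq_fderiv_comp hx, ContinuousLinearMap.comp_apply]
  congr 1
  obtain ⟨e, he⟩ := isInvertible_chartMetric (n := n) hx
  rw [← he, ContinuousLinearMap.inverse_equiv]
  rw [ContinuousLinearEquiv.coe_coe, ContinuousLinearEquiv.eq_symm_apply]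
  ext w
  have : e (chartDeriv x₀ x (grad n f x)) = chartMetric x₀ x (chartDeriv x₀ x (grad n f x)) := by
    rw [← he]; rfl
  rw [this, chartMetric_apply, chartFrame_chartDeriv hx, real_inner_comm, inner_grad_right,
    differential_eq_fderiv_comp hx, ContinuousLinearMap.comp_apply, chartDeriv_chartFrame hx]

/-! ### Volume densities and their transformation under a change of chart -/

lemma coordVector_eq {x₀ : M} {u : EuclideanSpace ℝ (Fin n)}
    (hu : u ∈ (extChartAt (𝓡 n) x₀).target) (i : Fin n) :
    coordVector x₀ u i =
      chartFrame x₀ ((extChartAt (𝓡 n) x₀).symm u) (EuclideanSpace.single i (1 : ℝ)) := by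
  have h1 := chartFrame_eq ((extChartAt (𝓡 n) x₀).map_target hu)
  -- The tangent spaces at propositionally equal points are different types; viewing both as the
  -- model space allows the base point to be replaced.
  have h2 := congrArg (fun u' ↦ (show EuclideanSpace ℝ (Fin n) →L[ℝ] EuclideanSpace ℝ (Fin n) from
    mfderiv 𝓘(ℝ, EuclideanSpace ℝ (Fin n)) (𝓡 n) (extChartAt (𝓡 n) x₀).symm u'))
    ((extChartAt (𝓡 n) x₀).right_inv hu)
  exact (congrArg (fun L : EuclideanSpace ℝ (Fin n) →L[ℝ] EuclideanSpace ℝ (Fin n) ↦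
    L (EuclideanSpace.single i (1 : ℝ))) (h1.trans h2)).symm

/-- The Gram matrix of the coordinate vector fields. -/
def chartGram (x₀ x : M) : Matrix (Fin n) (Fin n) ℝ :=
  Matrix.of fun i j ↦ chartMetric x₀ x (EuclideanSpace.single i (1 : ℝ))
    (EuclideanSpace.single j (1 : ℝ))

lemma volumeDensity_eq {x₀ : M} {u : EuclideanSpace ℝ (Fin n)}
    (hu : u ∈ (extChartAt (𝓡 n) x₀).target) :
    volumeDensity (n := n) x₀ u = √(chartGram (n := n) x₀ ((extChartAt (𝓡 n) x₀).symm u)).det := by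
  rw [volumeDensity]
  congr 2
  ext i j
  rw [Matrix.gram_apply, coordVector_eq hu, coordVector_eq hu]
  rfl

lemma volumeDensity_extChartAt {x₀ x : M} (hx : x ∈ (extChartAt (𝓡 n) x₀).source) :
    volumeDensity x₀ (extChartAt (𝓡 n) x₀ x) = √(chartGram (n := n) x₀ x).det := by
  rw [volumeDensity_eq ((extChartAt (𝓡 n) x₀).map_source hx),
    (extChartAt (𝓡 n) x₀).left_inv hx]

/-- If A is the matrix of J, the Gram matrix of the images is Aᵀ G A. -/
lemma det_of_bilin_comp (B : EuclideanSpace ℝ (Fin n) →L[ℝ] EuclideanSpace ℝ (Fin n) →L[ℝ] ℝ)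
    (J : EuclideanSpace ℝ (Fin n) →L[ℝ] EuclideanSpace ℝ (Fin n)) :
    (Matrix.of fun i j ↦ B (J (EuclideanSpace.single i (1 : ℝ)))
      (J (EuclideanSpace.single j (1 : ℝ)))).det =
    J.det ^ 2 * (Matrix.of fun i j ↦ B (EuclideanSpace.single i (1 : ℝ))
      (EuclideanSpace.single j (1 : ℝ))).det := by
  let b := (EuclideanSpace.basisFun (Fin n) ℝ).toBasis
  let A := LinearMap.toMatrix b b J.toLinearMap
  have hA : ∀ i, J (EuclideanSpace.single i (1 : ℝ)) =
      ∑ k, A k i • EuclideanSpace.single k (1 : ℝ) := by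
    intro i
    have := b.sum_repr (J (b i))
    simpa [A, LinearMap.toMatrix_apply, b] using this.symm
  have hdet : J.det = A.det := (LinearMap.det_toMatrix b J.toLinearMap).symm
  have hmat : (Matrix.of fun i j ↦ B (J (EuclideanSpace.single i (1 : ℝ)))
      (J (EuclideanSpace.single j (1 : ℝ)))) = A.transpose *
      (Matrix.of fun i j ↦ B (EuclideanSpace.single i (1 : ℝ))
        (EuclideanSpace.single j (1 : ℝ))) * A := by
    ext i j
    simp only [Matrix.of_apply, hA, map_sum, map_smul, sum_apply,
      smul_apply, Matrix.mul_apply, Matrix.transpose_apply, smul_eq_mul,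
      Finset.sum_mul, Finset.mul_sum]
    refine Finset.sum_congr rfl fun k _ ↦ Finset.sum_congr rfl fun l _ ↦ by ring
  rw [hmat, Matrix.det_mul, Matrix.det_mul, Matrix.det_transpose, hdet]
  ring

/-- The change of variables formula for the volume densities. -/
lemma volumeDensity_change {x y m : M} (hx : m ∈ (extChartAt (𝓡 n) x).source)
    (hy : m ∈ (extChartAt (𝓡 n) y).source) :
    volumeDensity (n := n) x (extChartAt (𝓡 n) x m) =
      |((chartDeriv y m).comp (chartFrame (n := n) x m)).det| *
        volumeDensity y (extChartAt (𝓡 n) y m) := by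
  rw [volumeDensity_extChartAt hx, volumeDensity_extChartAt hy, ← Real.sqrt_sq_eq_abs,
    ← Real.sqrt_mul (sq_nonneg _), chartGram, chartGram, ← det_of_bilin_comp]
  congr 2
  ext i j
  simp only [Matrix.of_apply, chartMetric_apply, ContinuousLinearMap.comp_apply,
    chartFrame_chartDeriv hy]

lemma continuous_det_fin (n : ℕ) : Continuous (Matrix.det : Matrix (Fin n) (Fin n) ℝ → ℝ) :=
  Continuous.matrix_det continuous_id

lemma continuousOn_det_chartGram
    [IsContinuousRiemannianBundle (EuclideanSpace ℝ (Fin n))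
      (fun x : M ↦ TangentSpace (𝓡 n) x)] (x₀ : M) :
    ContinuousOn (fun x ↦ (chartGram (n := n) x₀ x).det) (extChartAt (𝓡 n) x₀).source := by
  have h1 (v w : EuclideanSpace ℝ (Fin n)) :
      ContinuousOn (fun x ↦ chartMetric (n := n) x₀ x v w) (extChartAt (𝓡 n) x₀).source :=
    continuousOn_clm_apply.1 (continuousOn_clm_apply.1 (continuousOn_chartMetric (n := n) x₀) v) w
  have h : ContinuousOn (chartGram (n := n) x₀) (extChartAt (𝓡 n) x₀).source := by
    refine continuousOn_pi.2 fun i ↦ continuousOn_pi.2 fun j ↦ ?_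
    exact h1 _ _
  exact (continuous_det_fin n).comp_continuousOn h

/-! ### The Riemannian volume in a chart -/

section Volume

variable [MeasurableSpace M] [BorelSpace M]

lemma measurableSet_target_inter_symm_preimage (x : M) {A : Set M} (hA : MeasurableSet A) :
    MeasurableSet ((extChartAt (𝓡 n) x).target ∩ (extChartAt (𝓡 n) x).symm ⁻¹' A) := by
  have hT := (isOpen_extChartAt_target (I := 𝓡 n) x).measurableSet
  have h := (continuousOn_extChartAt_symm (I := 𝓡 n) x).domRestrict.measurable hA
  have := hT.subtype_image h
  convert this using 1
  ext u
  simp only [mem_inter_iff, mem_preimage, mem_image, Subtype.exists, domRestrict_apply]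
  constructor
  · rintro ⟨h1, h2⟩
    exact ⟨u, h1, h2, rfl⟩
  · rintro ⟨u', h1, h2, rfl⟩
    exact ⟨h1, h2⟩

lemma chartVolume_apply (x : M) {A : Set M} (hA : MeasurableSet A) :
    chartVolume (n := n) x A =
      ∫⁻ u in (extChartAt (𝓡 n) x).target ∩ (extChartAt (𝓡 n) x).symm ⁻¹' A,
        ENNReal.ofReal (volumeDensity (n := n) x u) := by
  have hT := (isOpen_extChartAt_target (I := 𝓡 n) x).measurableSet
  have hm : AEMeasurable (extChartAt (𝓡 n) x).symm
      (((volume : Measure (EuclideanSpace ℝ (Fin n))).restrict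
        (extChartAt (𝓡 n) x).target).withDensity
        (fun y ↦ ENNReal.ofReal (volumeDensity (n := n) x y))) :=
    ((continuousOn_extChartAt_symm (I := 𝓡 n) x).aemeasurable hT).mono_ac
      (withDensity_absolutelyContinuous _ _)
  rw [chartVolume, Measure.map_apply_of_aemeasurable hm hA]
  have hB := measurableSet_target_inter_symm_preimage (n := n) x hA
  -- The inverse chart has arbitrary values off the target, where the measure gives no mass.
  have h1 : (((volume : Measure (EuclideanSpace ℝ (Fin n))).restrict
        (extChartAt (𝓡 n) x).target).withDensity
        (fun y ↦ ENNReal.ofReal (volumeDensity (n := n) x y)))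
        ((extChartAt (𝓡 n) x).target)ᶜ = 0 := by
    apply withDensity_absolutelyContinuous
    rw [Measure.restrict_apply hT.compl]
    simp
  rw [← measure_inter_add_sdiff _ hT, add_comm, measure_mono_null (fun u hu ↦ hu.2) h1, zero_add,
    inter_comm, withDensity_apply _ hB, Measure.restrict_restrict hB, inter_right_comm, inter_self]

lemma fderiv_transition {x y m : M} (hx : m ∈ (extChartAt (𝓡 n) x).source)
    (hy : m ∈ (extChartAt (𝓡 n) y).source) :
    HasFDerivAt (extChartAt (𝓡 n) y ∘ (extChartAt (𝓡 n) x).symm)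
      ((chartDeriv y m).comp (chartFrame x m)) (extChartAt (𝓡 n) x m) := by
  have h1 : HasMFDerivAt 𝓘(ℝ, EuclideanSpace ℝ (Fin n)) (𝓡 n) (extChartAt (𝓡 n) x).symm
      (extChartAt (𝓡 n) x m)
      (mfderiv 𝓘(ℝ, EuclideanSpace ℝ (Fin n)) (𝓡 n) (extChartAt (𝓡 n) x).symm
        (extChartAt (𝓡 n) x m)) :=
    ((contMDiffOn_extChartAt_symm (n := ∞) x).contMDiffAt
      ((isOpen_extChartAt_target (I := 𝓡 n) x).mem_nhds
        ((extChartAt (𝓡 n) x).map_source hx)) |>.mdifferentiableAt (by simp)).hasMFDerivAt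
  have h2 : HasMFDerivAt (𝓡 n) 𝓘(ℝ, EuclideanSpace ℝ (Fin n)) (extChartAt (𝓡 n) y)
      ((extChartAt (𝓡 n) x).symm (extChartAt (𝓡 n) x m))
      (mfderiv (𝓡 n) 𝓘(ℝ, EuclideanSpace ℝ (Fin n)) (extChartAt (𝓡 n) y)
        ((extChartAt (𝓡 n) x).symm (extChartAt (𝓡 n) x m))) := by
    rw [(extChartAt (𝓡 n) x).left_inv hx]
    exact (mdifferentiableAt_extChartAt (by simpa using hy)).hasMFDerivAt
  have h3 := (HasMFDerivAt.comp _ h2 h1).hasFDerivAt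
  have key : ∀ m' : M, m' = m →
      (show EuclideanSpace ℝ (Fin n) →L[ℝ] EuclideanSpace ℝ (Fin n) from
        chartDeriv (n := n) y m) =
      (show EuclideanSpace ℝ (Fin n) →L[ℝ] EuclideanSpace ℝ (Fin n) from
        mfderiv (𝓡 n) 𝓘(ℝ, EuclideanSpace ℝ (Fin n)) (extChartAt (𝓡 n) y) m') := by
    rintro m' rfl
    exact chartDeriv_eq hy
  exact h3.congr_fderiv (congrArg₂
    (fun A B : EuclideanSpace ℝ (Fin n) →L[ℝ] EuclideanSpace ℝ (Fin n) ↦ A.comp B)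
    (key _ ((extChartAt (𝓡 n) x).left_inv hx)) (chartFrame_eq hx)).symm

/-- Change of variables under the transition map. Only an inequality, since the chart at y does not
see the points of A outside its own domain. -/
lemma chartVolume_le_chartVolume (x y : M) {A : Set M} (hA : MeasurableSet A)
    (hAx : A ⊆ (extChartAt (𝓡 n) x).source) :
    chartVolume (n := n) y A ≤ chartVolume (n := n) x A := by
  have hS : MeasurableSet (A ∩ (extChartAt (𝓡 n) y).source) :=
    hA.inter (isOpen_extChartAt_source (I := 𝓡 n) y).measurableSet
  have hy : (extChartAt (𝓡 n) y).target ∩ (extChartAt (𝓡 n) y).symm ⁻¹' A =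
      (extChartAt (𝓡 n) y ∘ (extChartAt (𝓡 n) x).symm) ''
        ((extChartAt (𝓡 n) x).target ∩ (extChartAt (𝓡 n) x).symm ⁻¹'
          (A ∩ (extChartAt (𝓡 n) y).source)) := by
    ext v
    constructor
    · rintro ⟨hv, hvA⟩
      have hvx := hAx hvA
      refine ⟨extChartAt (𝓡 n) x ((extChartAt (𝓡 n) y).symm v),
        ⟨(extChartAt (𝓡 n) x).map_source hvx, ?_⟩, ?_⟩
      · rw [mem_preimage, (extChartAt (𝓡 n) x).left_inv hvx]
        exact ⟨hvA, (extChartAt (𝓡 n) y).map_target hv⟩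
      · rw [Function.comp_apply, (extChartAt (𝓡 n) x).left_inv hvx,
          (extChartAt (𝓡 n) y).right_inv hv]
    · rintro ⟨u, ⟨-, huA, huy⟩, rfl⟩
      refine ⟨(extChartAt (𝓡 n) y).map_source huy, ?_⟩
      rw [mem_preimage, Function.comp_apply, (extChartAt (𝓡 n) y).left_inv huy]
      exact huA
  have hinj : InjOn (extChartAt (𝓡 n) y ∘ (extChartAt (𝓡 n) x).symm)
      ((extChartAt (𝓡 n) x).target ∩ (extChartAt (𝓡 n) x).symm ⁻¹'
          (A ∩ (extChartAt (𝓡 n) y).source)) :=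
    ((extChartAt (𝓡 n) y).injOn).comp
      ((extChartAt (𝓡 n) x).symm.injOn.mono inter_subset_left) (fun u hu ↦ hu.2.2)
  have hB := measurableSet_target_inter_symm_preimage (n := n) x hS
  rw [chartVolume_apply y hA, chartVolume_apply x hA, hy,
    lintegral_image_eq_lintegral_abs_det_fderiv_mul volume hB
      (f' := fun u ↦ (chartDeriv y ((extChartAt (𝓡 n) x).symm u)).comp
        (chartFrame x ((extChartAt (𝓡 n) x).symm u))) ?_ hinj]
  · refine le_trans (le_of_eq (setLIntegral_congr_fun hB ?_))
      (lintegral_mono_set (inter_subset_inter_right _ (preimage_mono inter_subset_left)))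
    rintro u ⟨hu, -, huy⟩
    have h := volumeDensity_change ((extChartAt (𝓡 n) x).map_target hu) huy
    rw [(extChartAt (𝓡 n) x).right_inv hu] at h
    simp only [Function.comp_apply]
    rw [h, ENNReal.ofReal_mul (abs_nonneg _)]
  · rintro u ⟨hu, -, huy⟩
    have h := fderiv_transition ((extChartAt (𝓡 n) x).map_target hu) huy
    rw [(extChartAt (𝓡 n) x).right_inv hu] at h
    exact h.hasFDerivWithinAt

lemma riemannianVolume_apply_of_subset (x : M) {A : Set M} (hA : MeasurableSet A)
    (hAx : A ⊆ (extChartAt (𝓡 n) x).source) :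
    riemannianVolume n M A = chartVolume (n := n) x A := by
  apply le_antisymm
  · have hS := (isOpen_extChartAt_source (I := 𝓡 n) x).measurableSet
    -- The supremum is bounded by exhibiting an upper bound of all chart measures that coincides
    -- with the measure of the chart at x on its domain.
    have hle : riemannianVolume n M ≤
        (riemannianVolume n M).restrict (extChartAt (𝓡 n) x).sourceᶜ + chartVolume (n := n) x := by
      refine iSup_le fun y ↦ Measure.le_intro fun B hB _ ↦ ?_
      rw [Measure.add_apply, Measure.restrict_apply hB, ← measure_inter_add_sdiff B hS, add_comm]
      refine add_le_add ?_ ?_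
      · rw [sdiff_eq]
        exact (le_iSup (fun y : M ↦ chartVolume (n := n) y) y : _ ≤ riemannianVolume n M) _
      · exact (chartVolume_le_chartVolume x y (hB.inter hS) inter_subset_right).trans
          (measure_mono inter_subset_left)
    have h := hle A
    rw [Measure.add_apply, Measure.restrict_apply hA, ← sdiff_eq, sdiff_eq_empty.2 hAx,
      measure_empty, zero_add] at h
    exact h
  · exact (le_iSup (fun y : M ↦ chartVolume (n := n) y) x : _ ≤ riemannianVolume n M) A

lemma ae_riemannianVolume_of_ae_chart (x : M) {P : EuclideanSpace ℝ (Fin n) → Prop}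
    (h : ∀ᵐ u, P u) :
    ∀ᵐ m ∂(riemannianVolume n M), m ∈ (extChartAt (𝓡 n) x).source →
      P (extChartAt (𝓡 n) x m) := by
  obtain ⟨N, hPN, hN, hN0⟩ := exists_measurable_superset_of_null (ae_iff.1 h)
  have hS := (isOpen_extChartAt_source (I := 𝓡 n) x)
  have hA : MeasurableSet ((extChartAt (𝓡 n) x).source ∩ extChartAt (𝓡 n) x ⁻¹' N) := by
    have h := hS.measurableSet.subtype_image
      ((continuousOn_extChartAt (I := 𝓡 n) x).domRestrict.measurable hN)
    convert h using 1
    ext u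
    simp only [mem_inter_iff, mem_preimage, mem_image, Subtype.exists, domRestrict_apply]
    constructor
    · rintro ⟨h1, h2⟩
      exact ⟨u, h1, h2, rfl⟩
    · rintro ⟨u', h1, h2, rfl⟩
      exact ⟨h1, h2⟩
  have h0 : riemannianVolume n M ((extChartAt (𝓡 n) x).source ∩ extChartAt (𝓡 n) x ⁻¹' N) = 0 := by
    rw [riemannianVolume_apply_of_subset x hA inter_subset_left, chartVolume_apply x hA]
    refine setLIntegral_measure_zero _ _ (measure_mono_null ?_ hN0)
    rintro u ⟨hu, -, huN⟩
    rwa [mem_preimage, (extChartAt (𝓡 n) x).right_inv hu] at huN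
  refine measure_mono_null ?_ h0
  intro m hm
  simp only [mem_compl_iff, mem_ofPred_eq, Classical.not_imp] at hm
  exact ⟨hm.1, hPN hm.2⟩

instance [IsContinuousRiemannianBundle (EuclideanSpace ℝ (Fin n))
      (fun x : M ↦ TangentSpace (𝓡 n) x)] : IsLocallyFiniteMeasure (riemannianVolume n M) := by
  refine ⟨fun x ↦ ?_⟩
  have hx := mem_extChartAt_source (I := 𝓡 n) x
  have hS := (isOpen_extChartAt_source (I := 𝓡 n) x)
  have hc := (continuousOn_det_chartGram (n := n) x).continuousAt (hS.mem_nhds hx)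
  set D := (chartGram (n := n) x x).det with hD
  -- Near x the density is at most √(D + 1) by continuity, and the coordinates stay in a unit ball
  -- of finite Lebesgue measure.
  have h1 : ∀ᶠ m in 𝓝 x, (chartGram (n := n) x m).det < D + 1 :=
    hc.eventually_lt continuousAt_const (by simp [D])
  have h2 : ∀ᶠ m in 𝓝 x, extChartAt (𝓡 n) x m ∈ Metric.ball (extChartAt (𝓡 n) x x) 1 :=
    (continuousAt_extChartAt x).eventually (Metric.ball_mem_nhds _ one_pos)
  obtain ⟨V, hV, hVo, hxV⟩ := eventually_nhds_iff.1 (h1.and (h2.and (hS.mem_nhds hx)))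
  refine ⟨V, hVo.mem_nhds hxV, ?_⟩
  rw [riemannianVolume_apply_of_subset x hVo.measurableSet fun m hm ↦ (hV m hm).2.2,
    chartVolume_apply x hVo.measurableSet]
  refine (setLIntegral_mono' (g := fun _ ↦ ENNReal.ofReal √(D + 1))
    (measurableSet_target_inter_symm_preimage (n := n) x hVo.measurableSet) ?_).trans_lt ?_
  · rintro u ⟨hu, huV⟩
    rw [volumeDensity_eq hu]
    exact ENNReal.ofReal_le_ofReal (Real.sqrt_le_sqrt (hV _ huV).1.le)
  · rw [setLIntegral_const]
    refine ENNReal.mul_lt_top ENNReal.ofReal_lt_top ?_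
    refine (measure_mono ?_).trans_lt (measure_ball_lt_top (x := extChartAt (𝓡 n) x x) (r := 1))
    rintro u ⟨hu, huV⟩
    have := (hV _ huV).2.1
    rwa [(extChartAt (𝓡 n) x).right_inv hu] at this

end Volume

/-! ### Mollification of Lipschitz functions -/

section Mollification

variable {E : Type*} [NormedAddCommGroup E] [InnerProductSpace ℝ E] [FiniteDimensional ℝ E]
  [MeasurableSpace E] [BorelSpace E]

open scoped Convolution

lemma integrable_normed_mul_comp_sub (b : ContDiffBump (0 : E)) {g : E → ℝ} (hg : Continuous g)
    (x : E) : Integrable (fun t ↦ b.normed volume t * g (x - t)) :=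
  Continuous.integrable_of_hasCompactSupport
    (b.continuous_normed.mul (hg.comp (continuous_const.sub continuous_id)))
    (b.hasCompactSupport_normed.mul_right)

lemma lipschitzWith_normed_convolution (b : ContDiffBump (0 : E)) {g : E → ℝ} {K : ℝ≥0}
    (hg : LipschitzWith K g) :
    LipschitzWith K (b.normed volume ⋆[ContinuousLinearMap.lsmul ℝ ℝ, volume] g) := by
  refine LipschitzWith.of_dist_le_mul fun x y ↦ ?_
  simp only [convolution_def, ContinuousLinearMap.lsmul_apply, smul_eq_mul]
  rw [Real.dist_eq, ← integral_sub (integrable_normed_mul_comp_sub b hg.continuous x)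
    (integrable_normed_mul_comp_sub b hg.continuous y)]
  have h1 : ∀ t, ‖b.normed volume t * g (x - t) - b.normed volume t * g (y - t)‖ ≤
      b.normed volume t * (K * dist x y) := by
    intro t
    rw [← mul_sub, norm_mul, Real.norm_of_nonneg (b.nonneg_normed t)]
    refine mul_le_mul_of_nonneg_left ?_ (b.nonneg_normed t)
    have := hg.dist_le_mul (x - t) (y - t)
    rwa [dist_sub_right] at this
  refine (norm_integral_le_of_norm_le (b.integrable_normed.mul_const _) (.of_forall h1)).trans ?_
  rw [integral_mul_const, b.integral_normed, one_mul]

/-- Differentiation under the integral: the difference quotients of the integrand are dominated by K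
times the bump, and g is differentiable almost everywhere by Rademacher's theorem. -/
lemma fderiv_normed_convolution (b : ContDiffBump (0 : E)) {g : E → ℝ} {K : ℝ≥0}
    (hg : LipschitzWith K g) (x : E) :
    fderiv ℝ (b.normed volume ⋆[ContinuousLinearMap.lsmul ℝ ℝ, volume] g) x =
      (b.normed volume ⋆[ContinuousLinearMap.lsmul ℝ ℝ, volume] fderiv ℝ g) x := by
  have hmeas : AEStronglyMeasurable (fun t ↦ b.normed volume t • fderiv ℝ g (x - t)) volume := by
    refine AEStronglyMeasurable.smul b.continuous_normed.aestronglyMeasurable ?_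
    exact ((measurable_fderiv ℝ g).comp (measurable_const.sub measurable_id)).aestronglyMeasurable
  have h := hasFDerivAt_integral_of_dominated_loc_of_lip (μ := (volume : Measure E)) (𝕜 := ℝ)
    (F := fun y t ↦ b.normed volume t * g (y - t)) (x₀ := x)
    (F' := fun t ↦ b.normed volume t • fderiv ℝ g (x - t))
    (bound := fun t ↦ b.normed volume t * K) (s := univ) univ_mem
    (.of_forall fun y ↦ (integrable_normed_mul_comp_sub b hg.continuous y).aestronglyMeasurable)
    (integrable_normed_mul_comp_sub b hg.continuous x) hmeas ?_
    (b.integrable_normed.mul_const _) ?_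
  · exact h.2.fderiv
  · refine .of_forall fun t ↦ LipschitzWith.lipschitzOnWith (LipschitzWith.of_dist_le_mul ?_)
    intro y z
    have hnn : 0 ≤ b.normed volume t * K := mul_nonneg (b.nonneg_normed t) K.2
    rw [Real.coe_nnabs, abs_of_nonneg hnn, Real.dist_eq, ← mul_sub, abs_mul,
      abs_of_nonneg (b.nonneg_normed t), mul_assoc]
    refine mul_le_mul_of_nonneg_left ?_ (b.nonneg_normed t)
    have := hg.dist_le_mul (y - t) (z - t)
    rwa [dist_sub_right, Real.dist_eq] at this
  · have hd : ∀ᵐ t, DifferentiableAt ℝ g (x - t) :=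
      (Measure.measurePreserving_sub_left volume x).quasiMeasurePreserving.ae
        hg.ae_differentiableAt
    filter_upwards [hd] with t ht
    have h1 : HasFDerivAt (fun y ↦ g (y - t)) (fderiv ℝ g (x - t)) x := by
      have := ht.hasFDerivAt.comp x ((hasFDerivAt_id x).sub_const t)
      simpa using! this
    exact h1.const_mul _

/-- Lipschitz functions are limits of smooth functions with the same Lipschitz constant, whose
derivatives converge almost everywhere. -/
theorem exists_smooth_approx_of_lipschitz {g : E → ℝ} {K : ℝ≥0} (hg : LipschitzWith K g)
    (h0 : ∀ x, 0 ≤ g x) :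
    ∃ G : ℕ → E → ℝ, (∀ k, ContDiff ℝ ∞ (G k)) ∧ (∀ k x, 0 ≤ G k x) ∧
      (∀ k, LipschitzWith K (G k)) ∧ (∀ k x, |G k x - g x| ≤ K) ∧
      (∀ x, Tendsto (fun k ↦ G k x) atTop (𝓝 (g x))) ∧
      ∀ᵐ x, Tendsto (fun k ↦ fderiv ℝ (G k) x) atTop (𝓝 (fderiv ℝ g x)) := by
  -- Outer radius at most 1 keeps the mollification within K of g; the fixed ratio 2 of the radii is
  -- what Lebesgue differentiation requires for convergence of the derivatives.
  let b : ℕ → ContDiffBump (0 : E) := fun k ↦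
    ⟨1 / (2 * (k + 1)), 1 / (k + 1), by positivity, by
      apply one_div_lt_one_div_of_lt <;> linarith [(Nat.cast_nonneg k : (0 : ℝ) ≤ k)]⟩
  have hb0 : Tendsto (fun k ↦ (b k).rOut) atTop (𝓝 0) := tendsto_one_div_add_atTop_nhds_zero_nat
  have hb1 : ∀ k, (b k).rOut ≤ 1 := by
    intro k
    change 1 / ((k : ℝ) + 1) ≤ 1
    rw [div_le_one (by positivity)]
    linarith [(Nat.cast_nonneg k : (0 : ℝ) ≤ k)]
  refine ⟨fun k ↦ (b k).normed volume ⋆[ContinuousLinearMap.lsmul ℝ ℝ, volume] g, ?_, ?_, ?_, ?_,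
    ?_, ?_⟩
  · intro k
    exact (b k).hasCompactSupport_normed.contDiff_convolution_left _ (b k).contDiff_normed
      hg.continuous.locallyIntegrable
  · intro k x
    simp only [convolution_def, ContinuousLinearMap.lsmul_apply, smul_eq_mul]
    exact integral_nonneg fun t ↦ mul_nonneg ((b k).nonneg_normed t) (h0 _)
  · exact fun k ↦ lipschitzWith_normed_convolution (b k) hg
  · intro k x
    have := (b k).dist_normed_convolution_le (μ := volume) (g := g) (x₀ := x) (ε := K)
      hg.continuous.aestronglyMeasurable (fun y hy ↦ by
        refine (hg.dist_le_mul y x).trans ?_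
        have h1 : dist y x ≤ 1 := (Metric.mem_ball.1 hy).le.trans (hb1 k)
        nlinarith [K.2])
    rwa [Real.dist_eq] at this
  · exact fun x ↦ ContDiffBump.convolution_tendsto_right_of_continuous hb0 hg.continuous x
  · have hloc : LocallyIntegrable (fderiv ℝ g) (volume : Measure E) :=
      (memLp_top_of_bound (measurable_fderiv ℝ g).aestronglyMeasurable K
        (.of_forall fun x ↦ norm_fderiv_le_of_lipschitz ℝ hg)).locallyIntegrable le_top
    have := ContDiffBump.ae_convolution_tendsto_right_of_locallyIntegrable (μ := volume) (φ := b)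
      (l := atTop) (K := 2) hb0 (.of_forall fun k ↦ by
        change 1 / ((k : ℝ) + 1) ≤ 2 * (1 / (2 * (k + 1)))
        apply le_of_eq
        field_simp) hloc
    filter_upwards [this] with x hx
    refine hx.congr fun k ↦ (fderiv_normed_convolution (b k) hg x).symm

end Mollification

/-! ### Functions that are Lipschitz in charts -/

/-- The function `f`, read in the chart at `x`, is Lipschitz near `x`. -/
def ChartLipschitzAt (n : ℕ) {M : Type*} [TopologicalSpace M]
    [ChartedSpace (EuclideanSpace ℝ (Fin n)) M] (f : M → ℝ) (x : M) : Prop :=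
  ∃ K : ℝ≥0, ∃ s ∈ 𝓝 (extChartAt (𝓡 n) x x),
    LipschitzOnWith K (f ∘ (extChartAt (𝓡 n) x).symm) s

lemma ChartLipschitzAt.congr {f g : M → ℝ} {x : M} (hf : ChartLipschitzAt n f x)
    (h : f =ᶠ[𝓝 x] g) : ChartLipschitzAt n g x := by
  obtain ⟨K, s, hs, hK⟩ := hf
  have h2 : ∀ᶠ u in 𝓝 (extChartAt (𝓡 n) x x),
      f ((extChartAt (𝓡 n) x).symm u) = g ((extChartAt (𝓡 n) x).symm u) := by
    have hc := continuousAt_extChartAt_symm (I := 𝓡 n) x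
    rw [ContinuousAt, extChartAt_to_inv] at hc
    exact hc.eventually h
  refine ⟨K, s ∩ {u | f ((extChartAt (𝓡 n) x).symm u) = g ((extChartAt (𝓡 n) x).symm u)},
    inter_mem hs h2, fun u hu v hv ↦ ?_⟩
  simp only [Function.comp_apply]
  rw [← hu.2, ← hv.2]
  exact hK hu.1 hv.1

/-- A C¹ function is locally Lipschitz. This serves products and the weight ρ^(1-p)|φ|^p alike. -/
lemma ChartLipschitzAt.comp₂ {f g : M → ℝ} {x : M} (hf : ChartLipschitzAt n f x)
    (hg : ChartLipschitzAt n g x) {G : ℝ × ℝ → ℝ} (hG : ContDiffAt ℝ 1 G (f x, g x)) :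
    ChartLipschitzAt n (fun y ↦ G (f y, g y)) x := by
  obtain ⟨K, s, hs, hK⟩ := hf
  obtain ⟨L, t, ht, hL⟩ := hg
  obtain ⟨C, w, hw, hC⟩ := hG.exists_lipschitzOnWith
  have hfc := hK.continuousOn.continuousAt hs
  have hgc := hL.continuousOn.continuousAt ht
  have hpair := hfc.prodMk hgc
  have hw' : (fun u ↦ ((f ∘ (extChartAt (𝓡 n) x).symm) u, (g ∘ (extChartAt (𝓡 n) x).symm) u)) ⁻¹' w
      ∈ 𝓝 (extChartAt (𝓡 n) x x) := by
    apply hpair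
    simpa only [Function.comp_apply, extChartAt_to_inv] using hw
  refine ⟨C * max K L, s ∩ t ∩ _, inter_mem (inter_mem hs ht) hw', ?_⟩
  exact hC.comp ((hK.mono (inter_subset_left.trans inter_subset_left)).prodMk
    (hL.mono (inter_subset_left.trans inter_subset_right))) (fun u hu ↦ hu.2)

lemma ContMDiff.chartLipschitzAt {f : M → ℝ} (hf : ContMDiff (𝓡 n) 𝓘(ℝ, ℝ) ∞ f) (x : M) :
    ChartLipschitzAt n f x := by
  have h1 : ContMDiffAt 𝓘(ℝ, EuclideanSpace ℝ (Fin n)) 𝓘(ℝ, ℝ) ∞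
      (f ∘ (extChartAt (𝓡 n) x).symm) (extChartAt (𝓡 n) x x) :=
    hf.contMDiffAt.comp _ ((contMDiffOn_extChartAt_symm x).contMDiffAt
      ((isOpen_extChartAt_target (I := 𝓡 n) x).mem_nhds (mem_extChartAt_target x)))
  obtain ⟨C, w, hw, hC⟩ := (h1.contDiffAt.of_le (m := 1) (by simp)).exists_lipschitzOnWith
  exact ⟨C, w, hw, hC⟩

lemma hasMFDerivAt_extChartAt_symm {x₀ : M} {u : EuclideanSpace ℝ (Fin n)}
    (hu : u ∈ (extChartAt (𝓡 n) x₀).target) :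
    HasMFDerivAt 𝓘(ℝ, EuclideanSpace ℝ (Fin n)) (𝓡 n) (extChartAt (𝓡 n) x₀).symm u
      (chartFrame x₀ ((extChartAt (𝓡 n) x₀).symm u)) := by
  have h0 := ((contMDiffOn_extChartAt_symm (I := 𝓡 n) (n := ∞) x₀).contMDiffAt
      ((isOpen_extChartAt_target (I := 𝓡 n) x₀).mem_nhds hu)
      |>.mdifferentiableAt (by simp)).hasMFDerivAt
  have h1 := chartFrame_eq ((extChartAt (𝓡 n) x₀).map_target hu)
  have h2 := congrArg (fun u' ↦ (show EuclideanSpace ℝ (Fin n) →L[ℝ] EuclideanSpace ℝ (Fin n) from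
    mfderiv 𝓘(ℝ, EuclideanSpace ℝ (Fin n)) (𝓡 n) (extChartAt (𝓡 n) x₀).symm u'))
    ((extChartAt (𝓡 n) x₀).right_inv hu)
  have h3 : mfderiv 𝓘(ℝ, EuclideanSpace ℝ (Fin n)) (𝓡 n) (extChartAt (𝓡 n) x₀).symm u =
    chartFrame x₀ ((extChartAt (𝓡 n) x₀).symm u) := (h1.trans h2).symm
  rwa [h3] at h0

/-! ### Local bounds for gradients -/

section Bounds

variable [IsContinuousRiemannianBundle (EuclideanSpace ℝ (Fin n))
      (fun x : M ↦ TangentSpace (𝓡 n) x)]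

lemma eventually_norm_chartDeriv_le (x : M) :
    ∃ C : ℝ, 0 < C ∧ ∀ᶠ y in 𝓝 x, ‖chartDeriv (n := n) x y‖ ≤ C := by
  obtain ⟨C, hC, h⟩ := eventually_norm_trivializationAt_lt (EuclideanSpace ℝ (Fin n))
    (fun x : M ↦ TangentSpace (𝓡 n) x) x
  exact ⟨C, hC, h.mono fun y hy ↦ hy.le⟩

lemma eventually_norm_chartFrame_le (x : M) :
    ∃ C : ℝ, 0 < C ∧ ∀ᶠ y in 𝓝 x, ‖chartFrame (n := n) x y‖ ≤ C := by
  obtain ⟨C, hC, h⟩ := eventually_norm_symmL_trivializationAt_lt (EuclideanSpace ℝ (Fin n))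
    (fun x : M ↦ TangentSpace (𝓡 n) x) x
  exact ⟨C, hC, h.mono fun y hy ↦ hy.le⟩

lemma norm_grad_le {x₀ x : M} (hx : x ∈ (extChartAt (𝓡 n) x₀).source) (f : M → ℝ) :
    ‖grad n f x‖ ≤ ‖fderiv ℝ (f ∘ (extChartAt (𝓡 n) x₀).symm) (extChartAt (𝓡 n) x₀ x)‖ *
      ‖chartDeriv (n := n) x₀ x‖ := by
  rw [norm_grad, differential_eq_fderiv_comp hx]
  exact ContinuousLinearMap.opNorm_comp_le _ _

lemma ChartLipschitzAt.eventually_norm_grad_le {f : M → ℝ} {x : M}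
    (hf : ChartLipschitzAt n f x) : ∃ B : ℝ, 0 ≤ B ∧ ∀ᶠ y in 𝓝 x, ‖grad n f y‖ ≤ B := by
  obtain ⟨K, s, hs, hK⟩ := hf
  obtain ⟨C, hC, h⟩ := eventually_norm_chartDeriv_le (n := n) x
  refine ⟨K * C, by positivity, ?_⟩
  filter_upwards [h, (isOpen_extChartAt_source (I := 𝓡 n) x).mem_nhds (mem_extChartAt_source x),
    (continuousAt_extChartAt x).eventually (eventually_mem_nhds_iff.2 hs)] with y h1 h2 h3
  refine (norm_grad_le h2 f).trans ?_
  gcongr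
  exact norm_fderiv_le_of_lipschitzOn ℝ h3 hK

lemma exists_norm_grad_le_on_compact {f : M → ℝ} (hf : ∀ x, ChartLipschitzAt n f x) {S : Set M}
    (hS : IsCompact S) : ∃ B : ℝ, 0 ≤ B ∧ ∀ x ∈ S, ‖grad n f x‖ ≤ B := by
  refine hS.induction_on (p := fun S ↦ ∃ B : ℝ, 0 ≤ B ∧ ∀ x ∈ S, ‖grad n f x‖ ≤ B)
    ⟨0, le_rfl, by simp⟩ ?_ ?_ ?_
  · rintro s t hst ⟨B, hB, h⟩
    exact ⟨B, hB, fun x hx ↦ h x (hst hx)⟩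
  · rintro s t ⟨B, hB, h⟩ ⟨B', hB', h'⟩
    refine ⟨max B B', le_max_of_le_left hB, ?_⟩
    rintro x (hx | hx)
    · exact (h x hx).trans (le_max_left _ _)
    · exact (h' x hx).trans (le_max_right _ _)
  · intro x hx
    obtain ⟨B, hB, h⟩ := (hf x).eventually_norm_grad_le
    exact ⟨_, mem_nhdsWithin_of_mem_nhds h, B, hB, fun y hy ↦ hy⟩

end Bounds

lemma grad_eq_zero_of_notMem_tsupport {f : M → ℝ} {x : M} (hx : x ∉ tsupport f) :
    grad n f x = 0 := by
  have h : f =ᶠ[𝓝 x] fun _ ↦ 0 := notMem_tsupport_iff_eventuallyEq.1 hx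
  have h2 : differential n f x = 0 := by
    rw [differential, h.mfderiv_eq]
    exact mfderiv_const
  rw [← norm_eq_zero, norm_grad, h2]
  exact norm_zero (E := TangentSpace (𝓡 n) x →L[ℝ] ℝ)

/-! ### Almost everywhere differentiability, measurability and integrability -/

section Measure

variable [MeasurableSpace M] [BorelSpace M] [SecondCountableTopology M]

/-- Rademacher's theorem in each chart, applied to a global Lipschitz extension of the local
coordinate expression. -/
lemma ae_mdifferentiableAt {f : M → ℝ} (hf : ∀ x, ChartLipschitzAt n f x) :
    ∀ᵐ x ∂(riemannianVolume n M), MDifferentiableAt (𝓡 n) 𝓘(ℝ, ℝ) f x := by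
  refine measure_null_of_locally_null _ fun x _ ↦ ?_
  obtain ⟨K, s, hs, hK⟩ := hf x
  obtain ⟨g, hg, hfg⟩ := hK.extend_real
  have h1 := ae_riemannianVolume_of_ae_chart (n := n) x
    (hg.ae_differentiableAt (μ := (volume : Measure (EuclideanSpace ℝ (Fin n)))))
  have hV : {y | y ∈ (extChartAt (𝓡 n) x).source ∧ s ∈ 𝓝 (extChartAt (𝓡 n) x y)} ∈ 𝓝 x :=
    inter_mem ((isOpen_extChartAt_source (I := 𝓡 n) x).mem_nhds (mem_extChartAt_source x))
      ((continuousAt_extChartAt x).eventually (eventually_mem_nhds_iff.2 hs))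
  refine ⟨_, inter_mem self_mem_nhdsWithin (mem_nhdsWithin_of_mem_nhds hV), ?_⟩
  refine measure_mono_null ?_ (ae_iff.1 h1)
  rintro y ⟨hy, hy1, hy2⟩
  simp only [mem_ofPred_eq, Classical.not_imp]
  refine ⟨hy1, fun hd ↦ hy ((mdifferentiableAt_iff_chart hy1 f).2 ?_)⟩
  exact hd.congr_of_eventuallyEq (hfg.eventuallyEq_of_mem hy2)

variable [IsContinuousRiemannianBundle (EuclideanSpace ℝ (Fin n))
      (fun x : M ↦ TangentSpace (𝓡 n) x)]

/-- No regularity of f and h is needed, as `fderiv` is measurable for every function. On each of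
countably many chart domains the inner product is a continuous expression in the two derivatives and
the inverse metric. -/
lemma aestronglyMeasurable_inner_grad (f h : M → ℝ) :
    AEStronglyMeasurable (fun x ↦ inner ℝ (grad n f x) (grad n h x)) (riemannianVolume n M) := by
  obtain ⟨s, hs, hU⟩ := TopologicalSpace.countable_cover_nhds
    (f := fun x : M ↦ (extChartAt (𝓡 n) x).source)
    (fun x ↦ (isOpen_extChartAt_source (I := 𝓡 n) x).mem_nhds (mem_extChartAt_source x))
  rw [← Measure.restrict_univ (μ := riemannianVolume n M), ← hU,
    biUnion_eq_iUnion]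
  have := hs.to_subtype
  refine aestronglyMeasurable_iUnion_iff.2 ?_
  rintro ⟨x, -⟩
  have hS := (isOpen_extChartAt_source (I := 𝓡 n) x).measurableSet
  have hc : AEMeasurable (extChartAt (𝓡 n) x)
      ((riemannianVolume n M).restrict (extChartAt (𝓡 n) x).source) :=
    (continuousOn_extChartAt x).aemeasurable hS
  have hinv : ContinuousOn (fun y ↦ (chartMetric (n := n) x y).inverse)
      (extChartAt (𝓡 n) x).source := by
    intro y hy
    obtain ⟨e, he⟩ := isInvertible_chartMetric (n := n) hy
    have h1 : ContinuousAt ContinuousLinearMap.inverse (chartMetric (n := n) x y) := by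
      rw [← he]
      exact (contDiffAt_map_inverse (𝕜 := ℝ) (n := 0) e).continuousAt
    exact h1.comp_continuousWithinAt (continuousOn_chartMetric x y hy)
  have hF (f : M → ℝ) : AEMeasurable (fun y ↦ fderiv ℝ (f ∘ (extChartAt (𝓡 n) x).symm)
      (extChartAt (𝓡 n) x y)) ((riemannianVolume n M).restrict (extChartAt (𝓡 n) x).source) :=
    (measurable_fderiv ℝ _).comp_aemeasurable hc
  have happ : AEStronglyMeasurable (fun y ↦ (chartMetric (n := n) x y).inverse
      (fderiv ℝ (f ∘ (extChartAt (𝓡 n) x).symm) (extChartAt (𝓡 n) x y)))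
      ((riemannianVolume n M).restrict (extChartAt (𝓡 n) x).source) :=
    (isBoundedBilinearMap_apply.continuous).comp_aestronglyMeasurable
      ((hinv.aestronglyMeasurable hS).prodMk (hF f).aestronglyMeasurable)
  have hall : AEStronglyMeasurable (fun y ↦ fderiv ℝ (h ∘ (extChartAt (𝓡 n) x).symm)
      (extChartAt (𝓡 n) x y) ((chartMetric (n := n) x y).inverse
      (fderiv ℝ (f ∘ (extChartAt (𝓡 n) x).symm) (extChartAt (𝓡 n) x y))))
      ((riemannianVolume n M).restrict (extChartAt (𝓡 n) x).source) :=
    (isBoundedBilinearMap_apply.continuous).comp_aestronglyMeasurable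
      ((hF h).aestronglyMeasurable.prodMk happ)
  refine hall.congr ?_
  filter_upwards [self_mem_ae_restrict hS] with y hy
  exact (inner_grad_grad_eq hy f h).symm

lemma integrable_of_bound_of_compact {F : M → ℝ} {S : Set M} (hS : IsCompact S)
    (hSm : MeasurableSet S) {B : ℝ}
    (hF : AEStronglyMeasurable F (riemannianVolume n M)) (hB : ∀ x ∈ S, ‖F x‖ ≤ B)
    (h0 : ∀ x ∉ S, F x = 0) : Integrable F (riemannianVolume n M) := by
  refine Integrable.mono' (g := S.indicator fun _ ↦ B) ?_ hF (.of_forall fun x ↦ ?_)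
  · exact (integrable_indicator_iff hSm).2 (integrableOn_const hS.measure_lt_top.ne)
  · by_cases hx : x ∈ S
    · simpa [hx] using hB x hx
    · simp [hx, h0 x hx]

lemma integrable_inner_grad [T2Space M] {f h : M → ℝ} (hf : ∀ x, ChartLipschitzAt n f x)
    (hh : ∀ x, ChartLipschitzAt n h x) (hc : HasCompactSupport h) :
    Integrable (fun x ↦ inner ℝ (grad n f x) (grad n h x)) (riemannianVolume n M) := by
  obtain ⟨B, hB, h1⟩ := exists_norm_grad_le_on_compact hf hc
  obtain ⟨B', hB', h2⟩ := exists_norm_grad_le_on_compact hh hc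
  refine integrable_of_bound_of_compact hc (isClosed_tsupport h).measurableSet (B := B * B')
    (aestronglyMeasurable_inner_grad f h) ?_ ?_
  · intro x hx
    refine (norm_inner_le_norm _ _).trans ?_
    gcongr
    exacts [h1 x hx, h2 x hx]
  · intro x hx
    rw [grad_eq_zero_of_notMem_tsupport hx, inner_zero_right]

end Measure

/-! ### Riemannian distance against chart coordinates -/

section Distance

variable {N : Type*} [EMetricSpace N]
  [ChartedSpace (EuclideanSpace ℝ (Fin n)) N] [IsManifold (𝓡 n) ∞ N]
  [RiemannianBundle (fun x : N ↦ TangentSpace (𝓡 n) x)]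
  [IsContinuousRiemannianBundle (EuclideanSpace ℝ (Fin n))
    (fun x : N ↦ TangentSpace (𝓡 n) x)]
  [IsRiemannianManifold (𝓡 n) N]

/-- The inverse of a chart is Lipschitz near the image of its base point. -/
lemma exists_lipschitzOnWith_extChartAt_symm (x : N) :
    ∃ K : ℝ≥0, ∃ s ∈ 𝓝 (extChartAt (𝓡 n) x x), LipschitzOnWith K (extChartAt (𝓡 n) x).symm s := by
  obtain ⟨C, hC, h⟩ := eventually_norm_chartFrame_le (n := n) x
  lift C to ℝ≥0 using hC.le
  have hsymm : ∀ᶠ u in 𝓝 (extChartAt (𝓡 n) x x),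
      ‖chartFrame (n := n) x ((extChartAt (𝓡 n) x).symm u)‖ ≤ C := by
    have hc := continuousAt_extChartAt_symm (I := 𝓡 n) x
    rw [ContinuousAt, extChartAt_to_inv] at hc
    exact hc.eventually h
  obtain ⟨r, hr, hball⟩ := Metric.mem_nhds_iff.1 (inter_mem hsymm
    ((isOpen_extChartAt_target (I := 𝓡 n) x).mem_nhds (mem_extChartAt_target x)))
  refine ⟨C, _, Metric.ball_mem_nhds _ hr, fun p hp q hq ↦ ?_⟩
  have hη : ∀ t ∈ Icc (0 : ℝ) 1, AffineMap.lineMap p q t ∈ Metric.ball (extChartAt (𝓡 n) x x) r := by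
    intro t ht
    apply (convex_ball _ _).segment_subset hp hq
    rw [segment_eq_image_lineMap]
    exact mem_image_of_mem _ ht
  have hηd : ∀ t : ℝ, HasMFDerivAt 𝓘(ℝ, ℝ) 𝓘(ℝ, EuclideanSpace ℝ (Fin n))
      (AffineMap.lineMap p q : ℝ → EuclideanSpace ℝ (Fin n)) t
      (ContinuousLinearMap.toSpanSingleton ℝ (q - p)) := fun t ↦
    (AffineMap.hasDerivAt_lineMap (a := p) (b := q) (x := t)).hasFDerivAt.hasMFDerivAt
  -- The distance is an infimum of lengths of paths. The image of the straight segment from p to q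
  -- is a competitor, with speed at most C‖q - p‖.
  rw [IsRiemannianManifold.out (I := 𝓡 n)]
  refine (riemannianEDist_le_pathELength (I := 𝓡 n) (a := 0) (b := 1)
    (γ := (extChartAt (𝓡 n) x).symm ∘ (AffineMap.lineMap p q : ℝ → EuclideanSpace ℝ (Fin n)))
    ?_ (by simp) (by simp) zero_le_one).trans ?_
  · refine (contMDiffOn_extChartAt_symm (n := 1) x).comp
      (t := (extChartAt (𝓡 n) x).target) ?_ (fun t ht ↦ (hball (hη t ht)).2)
    refine ContMDiff.contMDiffOn (contMDiff_iff_contDiff.2 ?_)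
    have hline : (AffineMap.lineMap p q : ℝ → EuclideanSpace ℝ (Fin n)) =
        fun t ↦ t • (q - p) + p := funext fun t ↦ AffineMap.lineMap_apply_module' p q t
    rw [hline]
    fun_prop
  · rw [pathELength_eq_lintegral_mfderiv_Icc]
    have hle : ∀ t ∈ Icc (0 : ℝ) 1, ‖mfderiv 𝓘(ℝ, ℝ) (𝓡 n) ((extChartAt (𝓡 n) x).symm ∘
        (AffineMap.lineMap p q : ℝ → EuclideanSpace ℝ (Fin n))) t 1‖ₑ ≤ C * edist p q := by
      intro t ht
      have h1 := HasMFDerivAt.comp t (hasMFDerivAt_extChartAt_symm (hball (hη t ht)).2) (hηd t)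
      rw [h1.mfderiv]
      have h2 : ‖chartFrame (n := n) x ((extChartAt (𝓡 n) x).symm (AffineMap.lineMap p q t))
          (q - p)‖ ≤ C * ‖q - p‖ :=
        ContinuousLinearMap.le_of_opNorm_le _ (hball (hη t ht)).1 _
      have h3 : (ContinuousLinearMap.toSpanSingleton ℝ (q - p)) (1 : ℝ) = q - p := by simp
      rw [edist_comm, edist_eq_enorm_sub]
      refine le_trans (le_of_eq (congrArg (fun v ↦ ‖chartFrame (n := n) x
        ((extChartAt (𝓡 n) x).symm (AffineMap.lineMap p q t)) v‖ₑ) h3)) ?_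
      rw [← ofReal_norm, ← ofReal_norm, ← ENNReal.ofReal_coe_nnreal,
        ← ENNReal.ofReal_mul (NNReal.coe_nonneg C)]
      exact ENNReal.ofReal_le_ofReal h2
    refine (setLIntegral_mono' measurableSet_Icc hle).trans ?_
    simp

lemma _root_.LocallyLipschitz.chartLipschitzAt {f : N → ℝ} (hf : LocallyLipschitz f) (x : N) :
    ChartLipschitzAt n f x := by
  obtain ⟨K, s, hs, hK⟩ := exists_lipschitzOnWith_extChartAt_symm (n := n) x
  obtain ⟨L, t, ht, hL⟩ := hf x
  have hc := continuousAt_extChartAt_symm (I := 𝓡 n) x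
  rw [ContinuousAt, extChartAt_to_inv] at hc
  exact ⟨L * K, _, inter_mem hs (hc ht), hL.comp (hK.mono inter_subset_left) fun u hu ↦ hu.2⟩

end Distance

/-! ### Products in a chart -/

lemma ChartLipschitzAt.continuousAt {f : M → ℝ} {x : M} (hf : ChartLipschitzAt n f x) :
    ContinuousAt f x := by
  obtain ⟨K, s, hs, hK⟩ := hf
  have h1 : ContinuousAt ((f ∘ (extChartAt (𝓡 n) x).symm) ∘ extChartAt (𝓡 n) x) x :=
    (hK.continuousOn.continuousAt hs).comp (continuousAt_extChartAt x)
  refine h1.congr ?_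
  filter_upwards [(isOpen_extChartAt_source (I := 𝓡 n) x).mem_nhds (mem_extChartAt_source x)]
    with y hy
  simp only [Function.comp_apply, (extChartAt (𝓡 n) x).left_inv hy]

lemma ChartLipschitzAt.mul {f g : M → ℝ} {x : M} (hf : ChartLipschitzAt n f x)
    (hg : ChartLipschitzAt n g x) : ChartLipschitzAt n (fun y ↦ f y * g y) x :=
  hf.comp₂ hg (G := fun z ↦ z.1 * z.2) (by fun_prop)

lemma contDiffOn_comp_extChartAt_symm {χ : M → ℝ} (hχ : ContMDiff (𝓡 n) 𝓘(ℝ, ℝ) ∞ χ) (x : M) :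
    ContDiffOn ℝ 1 (χ ∘ (extChartAt (𝓡 n) x).symm) (extChartAt (𝓡 n) x).target := by
  rw [← contMDiffOn_iff_contDiffOn]
  exact (hχ.of_le (by simp)).comp_contMDiffOn (contMDiffOn_extChartAt_symm x)

/-- The differential of a product of a smooth function and a function given in a chart. -/
lemma differential_mul_chart {x m : M} (hm : m ∈ (extChartAt (𝓡 n) x).source) {f χ : M → ℝ}
    (hχ : ContMDiff (𝓡 n) 𝓘(ℝ, ℝ) ∞ χ) {G : EuclideanSpace ℝ (Fin n) → ℝ}
    (hf : ∀ᶠ u in 𝓝 (extChartAt (𝓡 n) x m),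
      f ((extChartAt (𝓡 n) x).symm u) = χ ((extChartAt (𝓡 n) x).symm u) * G u)
    (hG : DifferentiableAt ℝ G (extChartAt (𝓡 n) x m)) :
    fderiv ℝ (f ∘ (extChartAt (𝓡 n) x).symm) (extChartAt (𝓡 n) x m) =
      χ m • fderiv ℝ G (extChartAt (𝓡 n) x m) + G (extChartAt (𝓡 n) x m) •
        fderiv ℝ (χ ∘ (extChartAt (𝓡 n) x).symm) (extChartAt (𝓡 n) x m) := by
  have h1 : DifferentiableAt ℝ (χ ∘ (extChartAt (𝓡 n) x).symm) (extChartAt (𝓡 n) x m) :=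
    (contDiffOn_comp_extChartAt_symm hχ x).contDiffAt
      ((isOpen_extChartAt_target (I := 𝓡 n) x).mem_nhds ((extChartAt (𝓡 n) x).map_source hm))
      |>.differentiableAt one_ne_zero
  have h2 : f ∘ (extChartAt (𝓡 n) x).symm =ᶠ[𝓝 (extChartAt (𝓡 n) x m)]
      (χ ∘ (extChartAt (𝓡 n) x).symm) * G := hf
  rw [h2.fderiv_eq, fderiv_mul h1 hG, Function.comp_apply, (extChartAt (𝓡 n) x).left_inv hm]

/-! ### Extension of the Laplacian inequality to Lipschitz test functions -/

section Extension

variable [MeasurableSpace M] [BorelSpace M] [SecondCountableTopology M] [T2Space M]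
  [IsContinuousRiemannianBundle (EuclideanSpace ℝ (Fin n))
    (fun x : M ↦ TangentSpace (𝓡 n) x)]

lemma aestronglyMeasurable_div_mul {ρ ψ : M → ℝ} (hρ : Continuous ρ) (hψ : Continuous ψ) (C : ℝ) :
    AEStronglyMeasurable (fun x ↦ C / ρ x * ψ x) (riemannianVolume n M) :=
  ((measurable_const.div hρ.measurable).mul hψ.measurable).aestronglyMeasurable

lemma exists_abs_le_on_compact {S : Set M} (hS : IsCompact S) {f : M → ℝ} (hf : ContinuousOn f S) :
    ∃ B : ℝ, 0 ≤ B ∧ ∀ x ∈ S, |f x| ≤ B := by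
  obtain ⟨B, hB⟩ := hS.exists_bound_of_continuousOn hf
  exact ⟨max B 0, le_max_right _ _, fun x hx ↦ (hB x hx).trans (le_max_left _ _)⟩

lemma integrable_div_mul {ρ ψ : M → ℝ} (hρ : Continuous ρ) (hψ : Continuous ψ)
    (hc : HasCompactSupport ψ) (hd : Disjoint (tsupport ψ) (ρ ⁻¹' {0})) (C : ℝ) :
    Integrable (fun x ↦ C / ρ x * ψ x) (riemannianVolume n M) := by
  have h1 : ContinuousOn (fun x ↦ C / ρ x * ψ x) (tsupport ψ) :=
    (continuousOn_const.div hρ.continuousOn fun x hx h0 ↦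
      disjoint_left.1 hd hx h0).mul hψ.continuousOn
  obtain ⟨B, hB, h⟩ := exists_abs_le_on_compact hc h1
  refine integrable_of_bound_of_compact hc (isClosed_tsupport ψ).measurableSet
    (aestronglyMeasurable_div_mul hρ hψ C) h fun x hx ↦ ?_
  rw [image_eq_zero_of_notMem_tsupport hx, mul_zero]

/-- The distributional inequality for the Laplacian holds for the product of a Lipschitz function
and a smooth function with small support. -/
lemma LaplacianGEDiv.exists_nhds_mul {ρ : M → ℝ} {C : ℝ} (hlap : LaplacianGEDiv n ρ C)
    (hρ : ∀ x, ChartLipschitzAt n ρ x) {ψ : M → ℝ} (hψ0 : ∀ x, 0 ≤ ψ x) {x : M} (hx : ρ x ≠ 0)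
    (hψ : ChartLipschitzAt n ψ x) :
    ∃ V : Set M, IsOpen V ∧ x ∈ V ∧ ∀ χ : M → ℝ, ContMDiff (𝓡 n) 𝓘(ℝ, ℝ) ∞ χ →
      (∀ y, 0 ≤ χ y) → tsupport χ ⊆ V →
      HasCompactSupport χ ∧ Disjoint (tsupport χ) (ρ ⁻¹' {0}) ∧
      ∫ y, C / ρ y * (χ y * ψ y) ∂(riemannianVolume n M) ≤
        -∫ y, inner ℝ (grad n ρ y) (grad n (fun y ↦ χ y * ψ y) y) ∂(riemannianVolume n M) := by
  have hρc : Continuous ρ := continuous_iff_continuousAt.2 fun x ↦ (hρ x).continuousAt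
  have : LocallyCompactSpace M := ChartedSpace.locallyCompactSpace (EuclideanSpace ℝ (Fin n)) M
  obtain ⟨K, s, hs, hK⟩ := hψ
  obtain ⟨D, hD, hDe⟩ := eventually_norm_chartDeriv_le (n := n) x
  obtain ⟨W, hWc, hxW⟩ := exists_compact_mem_nhds x
  obtain ⟨g₀, hg₀, hψg₀⟩ := hK.extend_real
  -- The truncation makes the extension nonnegative everywhere, hence also its mollifications, as
  -- test functions must be.
  set g : EuclideanSpace ℝ (Fin n) → ℝ := fun u ↦ max (g₀ u) 0 with hg_def
  have hg : LipschitzWith K g := hg₀.max_const 0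
  have hψg : ∀ u ∈ s, ψ ((extChartAt (𝓡 n) x).symm u) = g u := by
    intro u hu
    have h1 := hψg₀ hu
    simp only [Function.comp_apply] at h1
    rw [hg_def]
    simp only
    rw [← h1, max_eq_left (hψ0 _)]
  obtain ⟨G, hG, hG0, hGK, hGb, hGt, hGd⟩ := exists_smooth_approx_of_lipschitz hg
    (fun u ↦ le_max_right _ _)
  -- The conditions defining V: ψ is given there by g, gradients are controlled by coordinate
  -- derivatives, and functions supported in V have compact support off the zeros of ρ.
  have hall : ∀ᶠ y in 𝓝 x, y ∈ (extChartAt (𝓡 n) x).source ∧ ‖chartDeriv (n := n) x y‖ ≤ D ∧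
      s ∈ 𝓝 (extChartAt (𝓡 n) x y) ∧ ρ y ≠ 0 ∧ y ∈ W := by
    filter_upwards [(isOpen_extChartAt_source (I := 𝓡 n) x).mem_nhds (mem_extChartAt_source x),
      hDe, (continuousAt_extChartAt x).eventually (eventually_mem_nhds_iff.2 hs),
      hρc.continuousAt.eventually_ne hx, hxW] with y h1 h2 h3 h4 h5
    exact ⟨h1, h2, h3, h4, h5⟩
  obtain ⟨V, hV, hVo, hxV⟩ := eventually_nhds_iff.1 hall
  refine ⟨V, hVo, hxV, fun χ hχ hχ0 hχV ↦ ?_⟩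
  set S := tsupport χ with hS_def
  have hS : IsCompact S := hWc.of_isClosed_subset (isClosed_tsupport χ)
    fun y hy ↦ (hV y (hχV hy)).2.2.2.2
  have hSm : MeasurableSet S := (isClosed_tsupport χ).measurableSet
  have hdisj : Disjoint S (ρ ⁻¹' {0}) :=
    disjoint_left.2 fun y hy hy0 ↦ (hV y (hχV hy)).2.2.2.1 hy0
  refine ⟨hS, hdisj, ?_⟩
  have hSs : S ⊆ (extChartAt (𝓡 n) x).source := fun y hy ↦ (hV y (hχV hy)).1
  have hcS : ContinuousOn (extChartAt (𝓡 n) x) S := (continuousOn_extChartAt x).mono hSs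
  -- Only the Lipschitz factor is mollified. The smooth cutoff χ, supported in the chart domain,
  -- makes the product smooth on all of M.
  set Ψ : ℕ → M → ℝ := fun k y ↦ χ y * G k (extChartAt (𝓡 n) x y) with hΨ_def
  have hΨS : ∀ k, tsupport (Ψ k) ⊆ S := fun k ↦ tsupport_mul_subset_left
  have htest : ∀ k, IsTestFunctionOff n (ρ ⁻¹' {0}) (Ψ k) := by
    intro k
    refine ⟨contMDiff_of_tsupport fun y hy ↦ ?_, hS.of_isClosed_subset (isClosed_tsupport _) (hΨS k),
      hdisj.mono_left (hΨS k)⟩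
    have h1 : ContMDiffAt (𝓡 n) 𝓘(ℝ, EuclideanSpace ℝ (Fin n)) ∞ (extChartAt (𝓡 n) x) y :=
      contMDiffAt_extChartAt' (by simpa using hSs (hΨS k hy))
    exact (hχ.contMDiffAt (x := y)).mul ((hG k).contMDiff.contMDiffAt.comp y h1)
  have hineq : ∀ k, ∫ y, C / ρ y * Ψ k y ∂(riemannianVolume n M) ≤
      -∫ y, inner ℝ (grad n ρ y) (grad n (Ψ k) y) ∂(riemannianVolume n M) := fun k ↦
    hlap (Ψ k) (htest k) fun y ↦ mul_nonneg (hχ0 y) (hG0 k _)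
  obtain ⟨b₁, hb₁, hb₁S⟩ := exists_abs_le_on_compact hS (f := fun y ↦ C / ρ y)
    (continuousOn_const.div hρc.continuousOn fun y hy h0 ↦ disjoint_left.1 hdisj hy h0)
  obtain ⟨b₂, hb₂, hb₂S⟩ := exists_abs_le_on_compact hS hχ.continuous.continuousOn
  obtain ⟨b₃, hb₃, hb₃S⟩ := exists_abs_le_on_compact hS (f := fun y ↦ g (extChartAt (𝓡 n) x y))
    (hg.continuous.comp_continuousOn hcS)
  obtain ⟨b₄, hb₄⟩ := hS.exists_bound_of_continuousOn
    (f := fun y ↦ fderiv ℝ (χ ∘ (extChartAt (𝓡 n) x).symm) (extChartAt (𝓡 n) x y))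
    (((contDiffOn_comp_extChartAt_symm hχ x).continuousOn_fderiv_of_isOpen
      (isOpen_extChartAt_target x) le_rfl).comp hcS
      fun y hy ↦ (extChartAt (𝓡 n) x).map_source (hSs hy))
  obtain ⟨b₅, hb₅, hb₅S⟩ := exists_norm_grad_le_on_compact hρ hS
  -- A bound independent of k, from |G k - g| ≤ K, for use in dominated convergence.
  have hGle : ∀ k, ∀ y ∈ S, |G k (extChartAt (𝓡 n) x y)| ≤ b₃ + K := by
    intro k y hy
    have h1 := hGb k (extChartAt (𝓡 n) x y)
    have h2 := hb₃S y hy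
    have h3 := abs_sub_abs_le_abs_sub (G k (extChartAt (𝓡 n) x y)) (g (extChartAt (𝓡 n) x y))
    linarith
  have hfd : ∀ k, ∀ y ∈ S, fderiv ℝ (Ψ k ∘ (extChartAt (𝓡 n) x).symm) (extChartAt (𝓡 n) x y) =
      χ y • fderiv ℝ (G k) (extChartAt (𝓡 n) x y) + G k (extChartAt (𝓡 n) x y) •
        fderiv ℝ (χ ∘ (extChartAt (𝓡 n) x).symm) (extChartAt (𝓡 n) x y) := by
    intro k y hy
    refine differential_mul_chart (hSs hy) hχ ?_ ((hG k).differentiable (by simp) _)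
    filter_upwards [(isOpen_extChartAt_target (I := 𝓡 n) x).mem_nhds
      ((extChartAt (𝓡 n) x).map_source (hSs hy))] with u hu
    simp only [hΨ_def, (extChartAt (𝓡 n) x).right_inv hu]
  have hzero : ∀ y ∉ S, ∀ f : M → ℝ, grad n (fun y ↦ χ y * f y) y = 0 := fun y hy f ↦
    grad_eq_zero_of_notMem_tsupport fun h ↦ hy (tsupport_mul_subset_left h)
  have hlimL : Tendsto (fun k ↦ ∫ y, C / ρ y * Ψ k y ∂(riemannianVolume n M)) atTop
      (𝓝 (∫ y, C / ρ y * (χ y * ψ y) ∂(riemannianVolume n M))) := by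
    refine tendsto_integral_of_dominated_convergence (S.indicator fun _ ↦ b₁ * (b₂ * (b₃ + K)))
      (fun k ↦ aestronglyMeasurable_div_mul hρc (htest k).smooth.continuous C)
      ((integrable_indicator_iff hSm).2 (integrableOn_const hS.measure_lt_top.ne)) ?_ ?_
    · refine fun k ↦ .of_forall fun y ↦ ?_
      by_cases hy : y ∈ S
      · rw [indicator_of_mem hy, norm_mul, Real.norm_eq_abs, Real.norm_eq_abs, hΨ_def, abs_mul]
        have h1 := hb₁S y hy
        have h2 := hb₂S y hy
        have h3 := hGle k y hy
        gcongr
      · rw [indicator_of_notMem hy, image_eq_zero_of_notMem_tsupport fun h ↦ hy (hΨS k h)]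
        simp
    · refine .of_forall fun y ↦ ?_
      by_cases hy : y ∈ S
      · have h1 : ψ y = g (extChartAt (𝓡 n) x y) := by
          rw [← hψg _ (mem_of_mem_nhds (hV y (hχV hy)).2.2.1),
            (extChartAt (𝓡 n) x).left_inv (hSs hy)]
        rw [h1]
        exact ((hGt _).const_mul _).const_mul _
      · have h1 : χ y = 0 := image_eq_zero_of_notMem_tsupport hy
        simp [hΨ_def, h1]
  have hlimR : Tendsto (fun k ↦ ∫ y, inner ℝ (grad n ρ y) (grad n (Ψ k) y)
      ∂(riemannianVolume n M)) atTop
      (𝓝 (∫ y, inner ℝ (grad n ρ y) (grad n (fun y ↦ χ y * ψ y) y) ∂(riemannianVolume n M))) := by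
    refine tendsto_integral_of_dominated_convergence
      (S.indicator fun _ ↦ b₅ * ((b₂ * K + (b₃ + K) * b₄) * D))
      (fun k ↦ aestronglyMeasurable_inner_grad _ _)
      ((integrable_indicator_iff hSm).2 (integrableOn_const hS.measure_lt_top.ne)) ?_ ?_
    · refine fun k ↦ .of_forall fun y ↦ ?_
      by_cases hy : y ∈ S
      · rw [indicator_of_mem hy]
        refine (norm_inner_le_norm _ _).trans ?_
        refine mul_le_mul (hb₅S y hy) ?_ (norm_nonneg _) hb₅
        refine (norm_grad_le (hSs hy) _).trans ?_
        rw [hfd k y hy]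
        have h4 := hb₄ y hy
        have hb₄' : 0 ≤ b₄ := (norm_nonneg _).trans h4
        refine mul_le_mul ?_ (hV y (hχV hy)).2.1 (ContinuousLinearMap.opNorm_nonneg _) (by positivity)
        refine (norm_add_le _ _).trans ?_
        rw [norm_smul, norm_smul, Real.norm_eq_abs, Real.norm_eq_abs]
        have h2 := hb₂S y hy
        have h3 := hGle k y hy
        have h5 := norm_fderiv_le_of_lipschitz ℝ (hGK k) (x₀ := extChartAt (𝓡 n) x y)
        gcongr
      · rw [indicator_of_notMem hy, hΨ_def, hzero y hy, inner_zero_right, norm_zero]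
    -- The product rule for χψ needs g differentiable, and its limit needs the mollified derivatives
    -- to converge; both hold off a Lebesgue null set of the chart.
    · have hae := ae_riemannianVolume_of_ae_chart (n := n) x (hGd.and
        (hg.ae_differentiableAt (μ := (volume : Measure (EuclideanSpace ℝ (Fin n))))))
      filter_upwards [hae] with y hy'
      by_cases hy : y ∈ S
      · obtain ⟨h1, h2⟩ := hy' (hSs hy)
        have h3 := differential_mul_chart (f := fun y ↦ χ y * ψ y) (hSs hy) hχ (by
          filter_upwards [(hV y (hχV hy)).2.2.1] with u hu
          rw [hψg u hu]) h2
        simp only [inner_grad_right, differential_eq_fderiv_comp (hSs hy),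
          ContinuousLinearMap.comp_apply]
        rw [h3]
        simp only [hfd _ y hy]
        have h4 : Tendsto (fun k ↦ χ y • fderiv ℝ (G k) (extChartAt (𝓡 n) x y) +
            G k (extChartAt (𝓡 n) x y) •
              fderiv ℝ (χ ∘ (extChartAt (𝓡 n) x).symm) (extChartAt (𝓡 n) x y)) atTop
            (𝓝 (χ y • fderiv ℝ g (extChartAt (𝓡 n) x y) + g (extChartAt (𝓡 n) x y) •
              fderiv ℝ (χ ∘ (extChartAt (𝓡 n) x).symm) (extChartAt (𝓡 n) x y))) :=
          (h1.const_smul _).add ((hGt _).smul_const _)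
        exact ((ContinuousLinearMap.apply ℝ ℝ
          (chartDeriv x y (grad n ρ y))).continuous.tendsto _).comp h4
      · simp only [hΨ_def, hzero y hy, inner_zero_right]
        exact tendsto_const_nhds
  exact le_of_tendsto_of_tendsto' hlimL hlimR.neg hineq

lemma differential_sum {ι : Type*} (T : Finset ι) {F : ι → M → ℝ} {f : M → ℝ} {x : M}
    (hF : ∀ i ∈ T, MDifferentiableAt (𝓡 n) 𝓘(ℝ, ℝ) (F i) x) (hf : ∀ y, f y = ∑ i ∈ T, F i y) :
    differential n f x = ∑ i ∈ T, differential n (F i) x := by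
  have hx := mem_extChartAt_source (I := 𝓡 n) x
  have h1 : f ∘ (extChartAt (𝓡 n) x).symm =
      fun u ↦ ∑ i ∈ T, (F i ∘ (extChartAt (𝓡 n) x).symm) u := funext fun u ↦ hf _
  rw [differential_eq_fderiv_comp hx, h1,
    fderiv_fun_sum fun i hi ↦ (mdifferentiableAt_iff_chart hx _).1 (hF i hi)]
  ext v
  simp only [ContinuousLinearMap.comp_apply, sum_apply]
  exact Finset.sum_congr rfl fun i _ ↦ by
    rw [differential_eq_fderiv_comp hx, ContinuousLinearMap.comp_apply]

/-- The distributional inequality for the Laplacian extends to Lipschitz test functions. -/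
theorem LaplacianGEDiv.of_chartLipschitz {ρ : M → ℝ} {C : ℝ} (hlap : LaplacianGEDiv n ρ C)
    (hρ : ∀ x, ChartLipschitzAt n ρ x) {ψ : M → ℝ} (hψ0 : ∀ x, 0 ≤ ψ x)
    (hψ : ∀ x, ChartLipschitzAt n ψ x) (hψc : HasCompactSupport ψ)
    (hψd : Disjoint (tsupport ψ) (ρ ⁻¹' {0})) :
    ∫ x, C / ρ x * ψ x ∂(riemannianVolume n M) ≤
      -∫ x, inner ℝ (grad n ρ x) (grad n ψ x) ∂(riemannianVolume n M) := by
  have hρc : Continuous ρ := continuous_iff_continuousAt.2 fun x ↦ (hρ x).continuousAt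
  have hψcont : Continuous ψ := continuous_iff_continuousAt.2 fun x ↦ (hψ x).continuousAt
  have : LocallyCompactSpace M := ChartedSpace.locallyCompactSpace (EuclideanSpace ℝ (Fin n)) M
  choose V hVo hxV hV using fun x : {x : M // ρ x ≠ 0} ↦
    hlap.exists_nhds_mul hρ hψ0 x.2 (hψ x)
  obtain ⟨f, hf⟩ := SmoothPartitionOfUnity.exists_isSubordinate (𝓡 n) (isClosed_tsupport ψ) V hVo
    (fun x hx ↦ mem_iUnion.2 ⟨⟨x, fun h ↦ disjoint_left.1 hψd hx h⟩, hxV _⟩)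
  -- A locally finite family meets a compact set finitely often, so ψ splits as a finite sum and no
  -- interchange of limits arises.
  have hfin : {i | (tsupport (f i) ∩ tsupport ψ).Nonempty}.Finite :=
    f.locallyFinite.closure.finite_nonempty_inter_compact hψc
  set T := hfin.toFinset with hT
  have hsum : ∀ x, ψ x = ∑ i ∈ T, f i x * ψ x := by
    intro x
    by_cases hx : x ∈ tsupport ψ
    · have h1 := f.sum_eq_one hx
      rw [finsum_eq_sum_of_support_subset (s := T)] at h1
      · rw [← Finset.sum_mul, h1, one_mul]
      · intro i hi
        rw [hT, Finite.coe_toFinset]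
        exact ⟨x, subset_tsupport _ hi, hx⟩
    · simp [image_eq_zero_of_notMem_tsupport hx]
  have hlip : ∀ i x, ChartLipschitzAt n (fun y ↦ f i y * ψ y) x := fun i x ↦
    (ContMDiff.chartLipschitzAt (f i).contMDiff x).mul (hψ x)
  have hsub : ∀ i, tsupport (fun y ↦ f i y * ψ y) ⊆ tsupport ψ := fun i ↦ tsupport_mul_subset_right
  have hcs : ∀ i, HasCompactSupport (fun y ↦ f i y * ψ y) := fun i ↦ hψc.mul_left
  have hL : ∫ x, C / ρ x * ψ x ∂(riemannianVolume n M) =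
      ∑ i ∈ T, ∫ x, C / ρ x * (f i x * ψ x) ∂(riemannianVolume n M) := by
    rw [← integral_finsetSum T fun i _ ↦ integrable_div_mul hρc
      (ψ := fun x ↦ f i x * ψ x) ((f i).contMDiff.continuous.mul hψcont) (hcs i) (hψd.mono_left (hsub i)) C]
    refine integral_congr_ae (.of_forall fun x ↦ ?_)
    simp only
    rw [← Finset.mul_sum, ← hsum x]
  have hR : ∫ x, inner ℝ (grad n ρ x) (grad n ψ x) ∂(riemannianVolume n M) =
      ∑ i ∈ T, ∫ x, inner ℝ (grad n ρ x) (grad n (fun y ↦ f i y * ψ y) x)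
        ∂(riemannianVolume n M) := by
    rw [← integral_finsetSum T fun i _ ↦ integrable_inner_grad hρ (hlip i) (hcs i)]
    -- The gradient is additive only where every summand is differentiable, since it defaults to 0
    -- elsewhere.
    have hae : ∀ᵐ x ∂(riemannianVolume n M), ∀ i ∈ T,
        MDifferentiableAt (𝓡 n) 𝓘(ℝ, ℝ) (fun y ↦ f i y * ψ y) x :=
      (ae_ball_iff T.countable_toSet).2 fun i _ ↦ ae_mdifferentiableAt (hlip i)
    refine integral_congr_ae ?_
    filter_upwards [hae] with x hx
    simp only [inner_grad_right]
    rw [differential_sum T hx hsum, sum_apply]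
  rw [hL, hR, ← Finset.sum_neg_distrib]
  exact Finset.sum_le_sum fun i _ ↦
    (hV i (f i) (f i).contMDiff (f.nonneg i) (hf i)).2.2

end Extension

lemma isContinuousRiemannianBundle_of_contMDiff
    [h : IsContMDiffRiemannianBundle (𝓡 n) ∞ (EuclideanSpace ℝ (Fin n))
      (fun x : M ↦ TangentSpace (𝓡 n) x)] :
    IsContinuousRiemannianBundle (EuclideanSpace ℝ (Fin n))
      (fun x : M ↦ TangentSpace (𝓡 n) x) := by
  obtain ⟨g, hg, hg'⟩ := h.exists_contMDiff
  exact ⟨g, hg.continuous, hg'⟩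

/-- Here A, B, D and S stand for the integrals of (|φ|/ρ)^p, |∇φ|^p, ρ^q|φ|^q and φ². -/
lemma uncertainty_of_hardy_holder {A B D S C p q : ℝ} (hp0 : 0 < p) (hpq : 1 / p + 1 / q = 1)
    (hCp : 0 < C + 1 - p) (hA0 : 0 ≤ A) (hB0 : 0 ≤ B) (hD0 : 0 ≤ D)
    (hhardy : (C + 1 - p) * A ≤ p * (B ^ (1 / p) * A ^ (1 / q)))
    (hholder : S ≤ A ^ (1 / p) * D ^ (1 / q)) :
    (C + 1 - p) / p * S ≤ D ^ (1 / q) * B ^ (1 / p) := by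
  have hAB : (C + 1 - p) / p * A ^ (1 / p) ≤ B ^ (1 / p) := by
    -- Dividing the Hardy estimate by A^(1/q) requires A > 0; for A = 0 the claim is trivial.
    rcases hA0.eq_or_lt with h0 | hApos
    · rw [← h0, Real.zero_rpow (by positivity), mul_zero]
      positivity
    · have hsplit : A = A ^ (1 / p) * A ^ (1 / q) := by
        rw [← Real.rpow_add hApos, hpq, Real.rpow_one]
      have hAq : 0 < A ^ (1 / q) := Real.rpow_pos_of_pos hApos _
      rw [div_mul_eq_mul_div, div_le_iff₀ hp0]
      refine le_of_mul_le_mul_right ?_ hAq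
      calc (C + 1 - p) * A ^ (1 / p) * A ^ (1 / q)
          = (C + 1 - p) * A := by rw [mul_assoc, ← hsplit]
        _ ≤ p * (B ^ (1 / p) * A ^ (1 / q)) := hhardy
        _ = B ^ (1 / p) * p * A ^ (1 / q) := by ring
  calc (C + 1 - p) / p * S ≤ (C + 1 - p) / p * (A ^ (1 / p) * D ^ (1 / q)) := by gcongr
    _ = D ^ (1 / q) * ((C + 1 - p) / p * A ^ (1 / p)) := by ring
    _ ≤ D ^ (1 / q) * B ^ (1 / p) := by gcongr

/-! ### The Hardy inequality -/

section Hardy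

variable {ρ φ : M → ℝ} {p : ℝ}

lemma tsupport_hardyWeight_subset (hp : 1 < p) :
    tsupport (fun x ↦ ρ x ^ (1 - p) * |φ x| ^ p) ⊆ tsupport φ := by
  have h : Function.support (fun x ↦ ρ x ^ (1 - p) * |φ x| ^ p) ⊆ Function.support φ := by
    intro x hx h0
    exact hx (by simp [h0, Real.zero_rpow (by linarith : p ≠ 0)])
  exact closure_mono h

/-- On the support of φ, ρ ≠ 0 and |t|^p is C¹ as p > 1, so the weight is a C¹ function of (ρ, φ).
Off the support it vanishes locally, even at zeros of ρ. -/
lemma hardyWeight_chartLipschitzAt (hρ : ∀ x, ChartLipschitzAt n ρ x)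
    (hp : 1 < p) (hφ : IsTestFunctionOff n (ρ ⁻¹' {0}) φ) (x : M) :
    ChartLipschitzAt n (fun x ↦ ρ x ^ (1 - p) * |φ x| ^ p) x := by
  by_cases hx : x ∈ tsupport φ
  · have hpos : ρ x ≠ 0 := fun h ↦ disjoint_left.1 hφ.disjoint hx h
    refine (hρ x).comp₂ (ContMDiff.chartLipschitzAt hφ.smooth x)
      (G := fun z ↦ z.1 ^ (1 - p) * |z.2| ^ p) ?_
    refine (contDiffAt_fst.rpow_const_of_ne hpos).mul ?_
    exact ((contDiff_norm_rpow (E := ℝ) hp).contDiffAt).comp _ contDiffAt_snd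
  · refine ChartLipschitzAt.congr (f := fun _ ↦ 0)
      (ContMDiff.chartLipschitzAt contMDiff_const x) ?_
    filter_upwards [notMem_tsupport_iff_eventuallyEq.1 hx] with y hy
    rw [hy]
    simp [Real.zero_rpow (by linarith : p ≠ 0)]

lemma differential_hardyWeight {x : M} (hp : 1 < p) (hpos : ρ x ≠ 0)
    (hρd : MDifferentiableAt (𝓡 n) 𝓘(ℝ, ℝ) ρ x) (hφd : MDifferentiableAt (𝓡 n) 𝓘(ℝ, ℝ) φ x) :
    differential n (fun x ↦ ρ x ^ (1 - p) * |φ x| ^ p) x =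
      ((1 - p) * ρ x ^ (-p) * |φ x| ^ p) • differential n ρ x +
        (ρ x ^ (1 - p) * (p * |φ x| ^ (p - 2) * φ x)) • differential n φ x := by
  have hx := mem_extChartAt_source (I := 𝓡 n) x
  have hxx := (extChartAt (𝓡 n) x).left_inv hx
  have h1 := ((mdifferentiableAt_iff_chart hx ρ).1 hρd).hasFDerivAt
  have h2 := ((mdifferentiableAt_iff_chart hx φ).1 hφd).hasFDerivAt
  have h3 : HasDerivAt (fun a : ℝ ↦ a ^ (1 - p)) ((1 - p) * ρ x ^ (-p))
      ((ρ ∘ (extChartAt (𝓡 n) x).symm) (extChartAt (𝓡 n) x x)) := by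
    rw [Function.comp_apply, hxx]
    have := Real.hasDerivAt_rpow_const (x := ρ x) (p := 1 - p) (Or.inl hpos)
    rwa [show 1 - p - 1 = -p by ring] at this
  have h4 : HasDerivAt (fun a : ℝ ↦ |a| ^ p) (p * |φ x| ^ (p - 2) * φ x)
      ((φ ∘ (extChartAt (𝓡 n) x).symm) (extChartAt (𝓡 n) x x)) := by
    rw [Function.comp_apply, hxx]
    exact hasDerivAt_abs_rpow _ hp
  have h5 := (h3.comp_hasFDerivAt _ h1).mul (h4.comp_hasFDerivAt _ h2)
  have h6 := h5.fderiv
  rw [differential_eq_fderiv_comp hx, differential_eq_fderiv_comp hx,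
    differential_eq_fderiv_comp hx]
  have h7 : (fun x ↦ ρ x ^ (1 - p) * |φ x| ^ p) ∘ (extChartAt (𝓡 n) x).symm =
      ((fun a : ℝ ↦ a ^ (1 - p)) ∘ (ρ ∘ (extChartAt (𝓡 n) x).symm)) *
        ((fun a : ℝ ↦ |a| ^ p) ∘ (φ ∘ (extChartAt (𝓡 n) x).symm)) := rfl
  rw [h7, h6]
  simp only [Function.comp_apply, hxx]
  ext v
  simp only [ContinuousLinearMap.comp_apply, add_apply, smul_apply, smul_eq_mul]
  ring

/-- Zeros of ρ lie off the support of φ, and there the quotient is locally 0. -/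
lemma continuous_abs_div (hρ : Continuous ρ) (hφc : Continuous φ)
    (hφd : Disjoint (tsupport φ) (ρ ⁻¹' {0})) : Continuous fun x ↦ |φ x| / ρ x := by
  refine continuous_iff_continuousAt.2 fun x ↦ ?_
  by_cases hx : x ∈ tsupport φ
  · exact hφc.abs.continuousAt.div hρ.continuousAt fun h ↦ disjoint_left.1 hφd hx h
  · refine (continuousAt_const (y := (0 : ℝ))).congr ?_
    filter_upwards [notMem_tsupport_iff_eventuallyEq.1 hx] with y hy
    simp [hy]

/-- The pointwise lower bound for the derivative of the Hardy weight in the direction of `∇ρ`. -/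
lemma neg_inner_grad_hardyWeight_le {x : M} (hρ0 : ∀ x, 0 ≤ ρ x) (hp : 1 < p)
    (hφ : IsTestFunctionOff n (ρ ⁻¹' {0}) φ) (hgrad : ρ x ≠ 0 → ‖grad n ρ x‖ = 1)
    (hρd : MDifferentiableAt (𝓡 n) 𝓘(ℝ, ℝ) ρ x) (hφd : MDifferentiableAt (𝓡 n) 𝓘(ℝ, ℝ) φ x) :
    -inner ℝ (grad n ρ x) (grad n (fun x ↦ ρ x ^ (1 - p) * |φ x| ^ p) x) ≤
      (p - 1) * (|φ x| / ρ x) ^ p + p * (‖grad n φ x‖ * (|φ x| / ρ x) ^ (p - 1)) := by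
  by_cases hx : x ∈ tsupport φ
  · have hne : ρ x ≠ 0 := fun h ↦ disjoint_left.1 hφ.disjoint hx h
    have hpos : 0 < ρ x := lt_of_le_of_ne (hρ0 x) hne.symm
    rw [inner_grad_right, differential_hardyWeight hp hne hρd hφd, add_apply, smul_apply,
      smul_apply, ← inner_grad_right, ← inner_grad_right, real_inner_self_eq_norm_sq, hgrad hne,
      smul_eq_mul, smul_eq_mul]
    have h1 : |inner ℝ (grad n ρ x) (grad n φ x)| ≤ ‖grad n φ x‖ := by
      have := abs_real_inner_le_norm (grad n ρ x) (grad n φ x)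
      rwa [hgrad hne, one_mul] at this
    have h2 : ρ x ^ (-p) * |φ x| ^ p = (|φ x| / ρ x) ^ p := by
      rw [Real.div_rpow (abs_nonneg _) hpos.le, Real.rpow_neg hpos.le, div_eq_inv_mul]
    have h3 : ρ x ^ (1 - p) * |φ x| ^ (p - 1) = (|φ x| / ρ x) ^ (p - 1) := by
      rw [Real.div_rpow (abs_nonneg _) hpos.le, ← neg_sub p 1, Real.rpow_neg hpos.le,
        div_eq_inv_mul]
    -- For p < 2 the first factor has a negative exponent, but at φ x = 0 both sides are 0 because p
    -- > 1.
    have h4 : |φ x| ^ (p - 2) * |φ x| = |φ x| ^ (p - 1) := by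
      rcases eq_or_ne (φ x) 0 with h0 | h0
      · rw [h0, abs_zero, mul_zero, Real.zero_rpow (by linarith)]
      · rw [← Real.rpow_add_one (abs_ne_zero.2 h0)]
        congr 1
        ring
    have h5 : -(φ x * inner ℝ (grad n ρ x) (grad n φ x)) ≤ |φ x| * ‖grad n φ x‖ := by
      refine (neg_le_abs _).trans ?_
      rw [abs_mul]
      gcongr
    have h6 : 0 ≤ ρ x ^ (1 - p) * p * |φ x| ^ (p - 2) := by positivity
    have h7 := mul_le_mul_of_nonneg_left h5 h6
    rw [← h2, ← h3, ← h4]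
    nlinarith [h7]
  · have h0 : φ x = 0 := image_eq_zero_of_notMem_tsupport hx
    have hz : x ∉ tsupport (fun x ↦ ρ x ^ (1 - p) * |φ x| ^ p) := fun h ↦
      hx (tsupport_hardyWeight_subset hp h)
    rw [grad_eq_zero_of_notMem_tsupport hz, h0, inner_zero_right, abs_zero, zero_div,
      Real.zero_rpow (by linarith), Real.zero_rpow (by linarith)]
    simp

variable [MeasurableSpace M] [BorelSpace M] [SecondCountableTopology M] [T2Space M]
  [IsContinuousRiemannianBundle (EuclideanSpace ℝ (Fin n))
    (fun x : M ↦ TangentSpace (𝓡 n) x)]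

lemma memLp_norm_grad (hf : ∀ x, ChartLipschitzAt n φ x) (hc : HasCompactSupport φ) (hp : 0 < p) :
    MemLp (fun x ↦ ‖grad n φ x‖) (ENNReal.ofReal p) (riemannianVolume n M) := by
  have hm : AEStronglyMeasurable (fun x ↦ ‖grad n φ x‖) (riemannianVolume n M) := by
    refine (Real.continuous_sqrt.comp_aestronglyMeasurable
      (aestronglyMeasurable_inner_grad φ φ)).congr (.of_forall fun x ↦ ?_)
    simp only
    rw [real_inner_self_eq_norm_sq, Real.sqrt_sq (norm_nonneg _)]
  obtain ⟨B, hB, h⟩ := exists_norm_grad_le_on_compact hf hc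
  rw [← integrable_norm_rpow_iff hm (by simpa using hp) ENNReal.ofReal_ne_top,
    ENNReal.toReal_ofReal hp.le]
  refine integrable_of_bound_of_compact hc (isClosed_tsupport φ).measurableSet (B := B ^ p)
    ((Real.continuous_rpow_const hp.le).comp_aestronglyMeasurable hm.norm) ?_ ?_
  · intro x hx
    rw [norm_norm, Real.norm_of_nonneg (by positivity)]
    exact Real.rpow_le_rpow (norm_nonneg _) (h x hx) hp.le
  · intro x hx
    rw [grad_eq_zero_of_notMem_tsupport hx, norm_zero, norm_zero, Real.zero_rpow hp.ne']

/-- The `L^p` Hardy inequality, before division by a power of the left-hand side. -/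
theorem hardy_aux {C q : ℝ} (hρ0 : ∀ x, 0 ≤ ρ x) (hρ : ∀ x, ChartLipschitzAt n ρ x)
    (hgrad : ∀ᵐ x ∂(riemannianVolume n M), ρ x ≠ 0 → ‖grad n ρ x‖ = 1)
    (hlap : LaplacianGEDiv n ρ C) (hpq : p.HolderConjugate q)
    (hφ : IsTestFunctionOff n (ρ ⁻¹' {0}) φ) :
    (C + 1 - p) * ∫ x, (|φ x| / ρ x) ^ p ∂(riemannianVolume n M) ≤
      p * ((∫ x, ‖grad n φ x‖ ^ p ∂(riemannianVolume n M)) ^ (1 / p) *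
        (∫ x, (|φ x| / ρ x) ^ p ∂(riemannianVolume n M)) ^ (1 / q)) := by
  have hp : 1 < p := hpq.lt
  have hp0 : 0 < p := hpq.pos
  have hp1 : 0 < p - 1 := by linarith
  have hρc : Continuous ρ := continuous_iff_continuousAt.2 fun x ↦ (hρ x).continuousAt
  have hφl : ∀ x, ChartLipschitzAt n φ x := ContMDiff.chartLipschitzAt hφ.smooth
  have hw := continuous_abs_div hρc hφ.smooth.continuous hφ.disjoint
  have hw0 : ∀ x, 0 ≤ |φ x| / ρ x := fun x ↦ div_nonneg (abs_nonneg _) (hρ0 x)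
  have hwc : HasCompactSupport fun x ↦ |φ x| / ρ x :=
    hφ.hasCompactSupport.mono fun x hx h0 ↦ hx (by simp [show φ x = 0 from h0])
  have hwp : ∀ {r : ℝ}, 0 < r → HasCompactSupport fun x ↦ (|φ x| / ρ x) ^ r := fun hr ↦
    hwc.comp_left (g := fun a : ℝ ↦ a ^ _) (Real.zero_rpow hr.ne')
  have hwcont : ∀ {r : ℝ}, 0 < r → Continuous fun x ↦ (|φ x| / ρ x) ^ r := fun hr ↦
    hw.rpow_const fun _ ↦ Or.inr hr.le
  have hψc : HasCompactSupport (fun x ↦ ρ x ^ (1 - p) * |φ x| ^ p) :=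
    hφ.hasCompactSupport.of_isClosed_subset (isClosed_tsupport _) (tsupport_hardyWeight_subset hp)
  -- The exponent 1 - p is chosen so that C/ρ · ψ = C(|φ|/ρ)^p.
  have hL := hlap.of_chartLipschitz hρ (ψ := fun x ↦ ρ x ^ (1 - p) * |φ x| ^ p)
    (fun x ↦ mul_nonneg (Real.rpow_nonneg (hρ0 x) _) (Real.rpow_nonneg (abs_nonneg _) _))
    (hardyWeight_chartLipschitzAt hρ hp hφ) hψc
    (hφ.disjoint.mono_left (tsupport_hardyWeight_subset hp))
  have hleft : ∫ x, C / ρ x * (ρ x ^ (1 - p) * |φ x| ^ p) ∂(riemannianVolume n M) =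
      C * ∫ x, (|φ x| / ρ x) ^ p ∂(riemannianVolume n M) := by
    rw [← integral_const_mul]
    refine integral_congr_ae (.of_forall fun x ↦ ?_)
    simp only
    by_cases hx : φ x = 0
    · simp [hx, Real.zero_rpow hp0.ne']
    · have hne : ρ x ≠ 0 := fun h ↦
        disjoint_left.1 hφ.disjoint (subset_tsupport _ (Function.mem_support.2 hx)) h
      have hpos : 0 < ρ x := lt_of_le_of_ne (hρ0 x) hne.symm
      rw [Real.div_rpow (abs_nonneg _) hpos.le, Real.rpow_sub hpos, Real.rpow_one]
      field_simp
  have hg_mem := memLp_norm_grad (n := n) hφl hφ.hasCompactSupport hp0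
  have hw_mem : MemLp (fun x ↦ (|φ x| / ρ x) ^ (p - 1)) (ENNReal.ofReal q)
      (riemannianVolume n M) :=
    (hwcont hp1).memLp_of_hasCompactSupport (hwp hp1)
  have hcq : (ENNReal.ofReal p).HolderConjugate (ENNReal.ofReal q) := hpq.ennrealOfReal
  have hint1 : Integrable (fun x ↦ (|φ x| / ρ x) ^ p) (riemannianVolume n M) :=
    (hwcont hp0).integrable_of_hasCompactSupport (hwp hp0)
  have hint2 : Integrable (fun x ↦ ‖grad n φ x‖ * (|φ x| / ρ x) ^ (p - 1))
      (riemannianVolume n M) := hg_mem.integrable_mul hw_mem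
  have hright : -∫ x, inner ℝ (grad n ρ x) (grad n (fun x ↦ ρ x ^ (1 - p) * |φ x| ^ p) x)
      ∂(riemannianVolume n M) ≤ (p - 1) * ∫ x, (|φ x| / ρ x) ^ p ∂(riemannianVolume n M) +
        p * ∫ x, ‖grad n φ x‖ * (|φ x| / ρ x) ^ (p - 1) ∂(riemannianVolume n M) := by
    rw [← integral_const_mul, ← integral_const_mul, ← integral_add (hint1.const_mul _)
      (hint2.const_mul _), ← integral_neg]
    refine integral_mono_ae ?_ ((hint1.const_mul _).add (hint2.const_mul _)) ?_
    · exact (integrable_inner_grad hρ (hardyWeight_chartLipschitzAt hρ hp hφ) hψc).neg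
    · filter_upwards [hgrad, ae_mdifferentiableAt hρ, ae_mdifferentiableAt hφl] with x h1 h2 h3
      exact neg_inner_grad_hardyWeight_le hρ0 hp hφ h1 h2 h3
  have hholder := integral_mul_le_Lp_mul_Lq_of_nonneg hpq (μ := riemannianVolume n M)
    (.of_forall fun x ↦ norm_nonneg _) (.of_forall fun x ↦ Real.rpow_nonneg (hw0 x) _)
    hg_mem hw_mem
  -- As (p - 1)q = p, the second Hölder factor is again the Hardy integral.
  have hpow : ∀ x, ((|φ x| / ρ x) ^ (p - 1)) ^ q = (|φ x| / ρ x) ^ p := fun x ↦ by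
    rw [← Real.rpow_mul (hw0 x), hpq.sub_one_mul_conj]
  simp only [hpow] at hholder
  have h8 := mul_le_mul_of_nonneg_left hholder hp0.le
  -- Moving the term with p - 1 to the left turns the constant C into C + 1 - p.
  linarith

end Hardy

end RiemannianHardy

end

/-! ### The uncertainty inequality -/

theorem corollary2p5 {n : ℕ} (hn : 1 < n) {M : Type*} [EMetricSpace M]
    [SecondCountableTopology M] [MeasurableSpace M] [BorelSpace M]
    [ChartedSpace (EuclideanSpace ℝ (Fin n)) M] [IsManifold (𝓡 n) ∞ M]
    [RiemannianBundle (fun x : M ↦ TangentSpace (𝓡 n) x)]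
    [IsContMDiffRiemannianBundle (𝓡 n) ∞ (EuclideanSpace ℝ (Fin n))
      (fun x : M ↦ TangentSpace (𝓡 n) x)]
    [IsRiemannianManifold (𝓡 n) M] [CompleteSpace M] [NoncompactSpace M]
    (ρ : M → ℝ) (hρ_nonneg : ∀ x, 0 ≤ ρ x) (hρ_lip : LocallyLipschitz ρ)
    (hρ_grad : ∀ᵐ x ∂(RiemannianHardy.riemannianVolume n M),
      ρ x ≠ 0 → ‖RiemannianHardy.grad n ρ x‖ = 1)
    (C : ℝ) (hC : 0 < C) (hρ_lap : RiemannianHardy.LaplacianGEDiv n ρ C)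
    (p q : ℝ) (hp : 1 < p) (hpq : 1 / p + 1 / q = 1) (hCp : 0 < C + 1 - p)
    (φ : M → ℝ) (hφ : RiemannianHardy.IsTestFunctionOff n (ρ ⁻¹' {0}) φ) :
    Integrable (fun x ↦ ρ x ^ q * |φ x| ^ q) (RiemannianHardy.riemannianVolume n M) ∧
    Integrable (fun x ↦ ‖RiemannianHardy.grad n φ x‖ ^ p)
      (RiemannianHardy.riemannianVolume n M) ∧
    Integrable (fun x ↦ φ x ^ 2) (RiemannianHardy.riemannianVolume n M) ∧
    (C + 1 - p) / p * ∫ x, φ x ^ 2 ∂(RiemannianHardy.riemannianVolume n M) ≤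
      (∫ x, ρ x ^ q * |φ x| ^ q ∂(RiemannianHardy.riemannianVolume n M)) ^ (1 / q) *
        (∫ x, ‖RiemannianHardy.grad n φ x‖ ^ p ∂(RiemannianHardy.riemannianVolume n M)) ^
          (1 / p) := by
  have := RiemannianHardy.isContinuousRiemannianBundle_of_contMDiff (n := n) (M := M)
  have hpq' : p.HolderConjugate q := by
    rw [Real.holderConjugate_iff]
    exact ⟨hp, by simpa using hpq⟩
  have hp0 : 0 < p := hpq'.pos
  have hq0 : 0 < q := hpq'.symm.pos
  have hρ : ∀ x, RiemannianHardy.ChartLipschitzAt n ρ x := fun x ↦ hρ_lip.chartLipschitzAt x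
  have hρc := hρ_lip.continuous
  have hφc := hφ.smooth.continuous
  have hφl : ∀ x, RiemannianHardy.ChartLipschitzAt n φ x :=
    RiemannianHardy.ContMDiff.chartLipschitzAt hφ.smooth
  have hρφ : ∀ x, (ρ x * |φ x|) ^ q = ρ x ^ q * |φ x| ^ q := fun x ↦
    Real.mul_rpow (hρ_nonneg x) (abs_nonneg _)
  have hρφc : HasCompactSupport fun x ↦ ρ x * |φ x| :=
    hφ.hasCompactSupport.mono fun x hx h0 ↦ hx (by simp [show φ x = 0 from h0])
  have hρφ_mem : MemLp (fun x ↦ ρ x * |φ x|) (ENNReal.ofReal q)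
      (RiemannianHardy.riemannianVolume n M) :=
    (hρc.mul hφc.abs).memLp_of_hasCompactSupport hρφc
  have hw := RiemannianHardy.continuous_abs_div hρc hφc hφ.disjoint
  have hw0 : ∀ x, 0 ≤ |φ x| / ρ x := fun x ↦ div_nonneg (abs_nonneg _) (hρ_nonneg x)
  have hw_mem : MemLp (fun x ↦ |φ x| / ρ x) (ENNReal.ofReal p)
      (RiemannianHardy.riemannianVolume n M) :=
    hw.memLp_of_hasCompactSupport
      (hφ.hasCompactSupport.mono fun x hx h0 ↦ hx (by simp [show φ x = 0 from h0]))
  refine ⟨?_, ?_, ?_, ?_⟩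
  · have h1 := (integrable_norm_rpow_iff hρφ_mem.1 (by simpa using hq0)
      ENNReal.ofReal_ne_top).2 hρφ_mem
    rw [ENNReal.toReal_ofReal hq0.le] at h1
    refine h1.congr (.of_forall fun x ↦ ?_)
    simp only
    rw [Real.norm_of_nonneg (mul_nonneg (hρ_nonneg x) (abs_nonneg _)), hρφ]
  · have h1 := RiemannianHardy.memLp_norm_grad hφl hφ.hasCompactSupport hp0
    have h2 := (integrable_norm_rpow_iff h1.1 (by simpa using hp0) ENNReal.ofReal_ne_top).2 h1
    rw [ENNReal.toReal_ofReal hp0.le] at h2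
    simpa only [norm_norm] using h2
  · have hsqc : HasCompactSupport fun x ↦ φ x ^ 2 :=
      hφ.hasCompactSupport.mono fun x hx h0 ↦ hx (by simp [show φ x = 0 from h0])
    exact Continuous.integrable_of_hasCompactSupport (hφc.pow 2) hsqc
  · have hhardy := RiemannianHardy.hardy_aux hρ_nonneg hρ hρ_grad hρ_lap hpq' hφ
    have hholder := integral_mul_le_Lp_mul_Lq_of_nonneg hpq'
      (μ := RiemannianHardy.riemannianVolume n M) (.of_forall hw0)
      (.of_forall fun x ↦ mul_nonneg (hρ_nonneg x) (abs_nonneg _)) hw_mem hρφ_mem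
    -- Cancelling ρ is legitimate where φ ≠ 0, since ρ is nonzero on the support of φ.
    have hsq : ∀ x, |φ x| / ρ x * (ρ x * |φ x|) = φ x ^ 2 := by
      intro x
      by_cases hx : φ x = 0
      · simp [hx]
      · have hne : ρ x ≠ 0 := fun h ↦ Set.disjoint_left.1 hφ.disjoint
          (subset_tsupport _ (Function.mem_support.2 hx)) h
        rw [← sq_abs]
        field_simp
    simp only [hsq, hρφ] at hholder
    exact RiemannianHardy.uncertainty_of_hardy_holder hp0 hpq hCp
      (integral_nonneg fun x ↦ Real.rpow_nonneg (hw0 x) _)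
      (integral_nonneg fun x ↦ Real.rpow_nonneg (norm_nonneg _) _)
      (integral_nonneg fun x ↦
        mul_nonneg (Real.rpow_nonneg (hρ_nonneg x) _) (Real.rpow_nonneg (abs_nonneg _) _))
      hhardy hholder
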